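/- **Notation.** For real $\kappa$ let $\Gamma^{\kappa}(z)$ be the branch of the power that is holomorphic on $\mathbb C\setminus(-\infty,0]$ and positive for $z>0$ (for $\kappa\in\mathbb N$ it is the ordinary power). For triples $(a_i,A_i,\alpha_i)_{1,p}$, $(b_j,B_j,\beta_j)_{1,q}$ with $a_i,b_j\in\mathbb C$ and integers $0\le n\le p$, $0\le m\le q$, put $$\chi(s)=\frac{\prod_{i=1}^{n}\Gamma^{\alpha_i}(1-a_i-A_is)\prod_{j=1}^{m}\Gamma^{\beta_j}(b_j+B_js)}{\prod_{i=n+1}^{p}\Gamma^{\alpha_i}(a_i+A_is)\prod_{j=m+1}^{q}\Gamma^{\beta_j}(1-b_j-B_js)}.$$ A line $\operatorname{Re}s=c$ is *admissible* if the singularities of the factors $\Gamma^{\alpha_i}(1-a_i-A_is)$, $i\le n$, lie to its right, those of $\Gamma^{\beta_j}(b_j+B_js)$, $j\le m$, lie to its left, and it does not meet the branch cut of a denominator factor with non-integer exponent (a factor with zero scale, $A_i=0$ or $B_j=0$, is a constant and must be finite). For $z\ne0$, with $z^{-s}$ the principal power, $$I^{m,n}_{p,q}\Big[z\,\Big|\,{(a_i,A_i,\alpha_i)_{1,p}\atop(b_j,B_j,\beta_j)_{1,q}}\Big]=\frac1{2\pi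 i}\int_{c-i\infty}^{c+i\infty}\chi(s)z^{-s}\,ds$$ along any admissible line on which the integral converges absolutely; if there is such a line, $I(z)$ is said to be *defined*. **Distribution.** Let all $A_i,\alpha_i,B_j,\beta_j>0$, let $\sigma\ge0$, $\delta\in\mathbb C\setminus\{0\}$, let $I(\delta)$ be defined, and let $\alpha,a,b\in\mathbb R$ satisfy: $a>0,b\ge0$ if $\alpha>0$; $a\ge0,b>0$ if $\alpha<0$; $a,b>0$ if $\alpha=0$. A random variable $X$ has the $I$-FIG distribution with constant $k_2\in\mathbb C$ if it has the probability density $$f_X(x)=k_2x^{\alpha-1}e^{-ax-bx^{-1}}\,I^{m,n}_{p,q}\Big[\delta x^{\sigma}\,\Big|\,{(a_i,A_i,\alpha_i)_{1,p}\atop(b_j,B_j,\beta_j)_{1,q}}\Big]\ge0\quad(x>0),\qquad f_X(x)=0\quad(x\le0).$$ Assume $a>0$, or $a=0$ and $\sigma=0$ (so that $\delta/a^{\sigma}$ below makes sense, with $0^0=1$). For real $r$ and $l=0,1,2,\dots$ put $$T_l(r)=\Bigg\{a^{-\alpha-r}I^{m+1,n+1}_{p+2,q+1}\Big[\frac{\delta}{a^{\sigma}}\Big|{(1-\alpha-r,\sigma,1)\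 (a_i,A_i,\alpha_i)_{1,p}\ (1+l-\alpha-r,\sigma,1)\atop(1-\alpha-r,\sigma,1)\ (b_j,B_j,\beta_j)_{1,q}}\Big]-b^{\alpha+r}I^{m+1,n+1}_{p+1,q+2}\Big[b^{\sigma}\delta\Big|{(1-\alpha-r,\sigma,1)\ (a_i,A_i,\alpha_i)_{1,p}\atop(1-\alpha-r,\sigma,1)\ (b_j,B_j,\beta_j)_{1,q}\ (-l-\alpha-r,\sigma,1)}\Big]\Bigg\}\frac{(ab)^l}{l!},$$ where for $b=0$ the second summand in the braces is read as $0$, and $(ab)^0=1$. Let $(\mathrm H_r)$ be the assumption that some line is admissible for all the $I$-functions in $T_l(r)$, $l\ge0$, and that the integral defining $I(\delta)$ converges absolutely along it. **Corollary (moments and normalizing constant of $I$-FIG).** 1. Let $r\ge0$ be real (if $a=0$, assume $\alpha+r<0$), and assume $(\mathrm H_r)$. Then the $I$-functions in $T_l(r)$ are defined (the second one if $b\ne0$), $X$ has a finite $r$-th moment, the series $\sum_lT_l(r)$ converges absolutely, and $$\mu_r'=E[X^r]=k_2\sum_{l=0}^{\infty}T_l(r).$$ 2. Hence, if $(\mathrm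 H_0)$ holds, the series $\sum_lT_l(0)$ converges absolutely, $k_2\neq0$, and $$k_2^{-1}=\sum_{l=0}^{\infty}T_l(0).$$ -/

import Mathlib

open MeasureTheory Filter Topology

noncomputable section

/-- The power `Γ^κ(z)`, for real `κ`, in the branch that is holomorphic off `(-∞, 0]` and positive
on the positive real axis: the limit of the `κ`-th powers of Euler's products
`n^z n! / (z (z + 1) ⋯ (z + n))`, the power being taken factor by factor with principal values.
For a natural number `κ` it is the ordinary power of `Γ(z)`. -/
def gammaPow (κ : ℝ) (z : ℂ) : ℂ :=
  limUnder atTop fun n : ℕ =>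
    (n : ℂ) ^ ((κ : ℂ) * z) * (n.factorial : ℂ) ^ (κ : ℂ) /
      ∏ j ∈ Finset.range (n + 1), (z + (j : ℂ)) ^ (κ : ℂ)

/-- One parameter triple, `(a_i, A_i, α_i)` or `(b_j, B_j, β_j)`, of an `I`-function. -/
structure IFactor where
  coef : ℂ
  scale : ℝ
  power : ℝ

/-- The parameters of an `I`-function `I^{m,n}_{p,q}`: `upperNum` lists the triples
`(a_i, A_i, α_i)` with `1 ≤ i ≤ n`, `upperDen` those with `n < i ≤ p`, `lowerNum` lists the triples
`(b_j, B_j, β_j)` with `1 ≤ j ≤ m`, and `lowerDen` those with `m < j ≤ q`. -/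
structure IParams where
  upperNum : List IFactor
  upperDen : List IFactor
  lowerNum : List IFactor
  lowerDen : List IFactor

namespace IParams

/-- All the `A_i, α_i, B_j, β_j` are positive. -/
def IsValid (P : IParams) : Prop :=
  ∀ t ∈ P.upperNum ++ P.upperDen ++ P.lowerNum ++ P.lowerDen, 0 < t.scale ∧ 0 < t.power

/-- The kernel `χ(s)` of the Mellin-Barnes integral. -/
def chi (P : IParams) (s : ℂ) : ℂ :=
  ((P.upperNum.map fun t => gammaPow t.power (1 - t.coef - t.scale * s)).prod *
      (P.lowerNum.map fun t => gammaPow t.power (t.coef + t.scale * s)).prod) /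
    ((P.upperDen.map fun t => gammaPow t.power (t.coef + t.scale * s)).prod *
      (P.lowerDen.map fun t => gammaPow t.power (1 - t.coef - t.scale * s)).prod)

/-- The line `Re s = c` is an admissible path of integration: the singularities of the numerator
factors `Γ^{α_i}(1 - a_i - A_i s)` lie to its right and those of `Γ^{β_j}(b_j + B_j s)` to its left,
and it does not meet the branch cut of a denominator factor whose exponent is not an integer. -/
structure IsPath (P : IParams) (c : ℝ) : Prop where
  right : ∀ t ∈ P.upperNum, ∀ (s : ℂ) (k : ℕ), 1 - t.coef - t.scale * s = -(k : ℂ) → c < s.re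
  left : ∀ t ∈ P.lowerNum, ∀ (s : ℂ) (k : ℕ), t.coef + t.scale * s = -(k : ℂ) → s.re < c
  cut_upper : ∀ t ∈ P.upperDen, (¬ ∃ k : ℕ, t.power = k) →
    ∀ s : ℂ, s.re = c → t.coef + t.scale * s ∈ Complex.slitPlane
  cut_lower : ∀ t ∈ P.lowerDen, (¬ ∃ k : ℕ, t.power = k) →
    ∀ s : ℂ, s.re = c → 1 - t.coef - t.scale * s ∈ Complex.slitPlane

/-- `χ(s) z^{-s}` at `s = c + i t`. -/
def integrand (P : IParams) (c : ℝ) (z : ℂ) (t : ℝ) : ℂ :=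
  P.chi (c + t * Complex.I) * z ^ (-((c : ℂ) + t * Complex.I))

/-- The Mellin-Barnes integral along `Re s = c` converges absolutely at `z`. -/
def AbsConv (P : IParams) (c : ℝ) (z : ℂ) : Prop :=
  Integrable (P.integrand c z)

/-- `(2πi)⁻¹ ∫ χ(s) z^{-s} ds` along `s = c + i t`, where `ds = i dt`. -/
def barnesIntegral (P : IParams) (c : ℝ) (z : ℂ) : ℂ :=
  (2 * Real.pi * Complex.I)⁻¹ * ∫ t : ℝ, P.integrand c z t * Complex.I

/-- `I(z)` makes sense: `z ≠ 0`, and the Mellin-Barnes integral converges absolutely along some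
admissible path. -/
def Defined (P : IParams) (z : ℂ) : Prop :=
  z ≠ 0 ∧ ∃ c : ℝ, P.IsPath c ∧ P.AbsConv c z

open Classical in
/-- The `I`-function: the Mellin-Barnes integral along an admissible path on which it converges
absolutely (by Cauchy's theorem the choice of that path does not matter). -/
def iFunction (P : IParams) (z : ℂ) : ℂ :=
  if h : P.Defined z then P.barnesIntegral h.2.choose z else 0

/-- Parameters of the first `I^{m+1,n+1}_{p+2,q+1}` in the `l`-th term of the moment series. -/
def momentFst (P : IParams) (α σ r : ℝ) (l : ℕ) : IParams where
  upperNum := ⟨1 - α - r, σ, 1⟩ :: P.upperNum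
  upperDen := P.upperDen ++ [⟨1 + l - α - r, σ, 1⟩]
  lowerNum := ⟨1 - α - r, σ, 1⟩ :: P.lowerNum
  lowerDen := P.lowerDen

/-- Parameters of the second `I^{m+1,n+1}_{p+1,q+2}` in the `l`-th term of the moment series. -/
def momentSnd (P : IParams) (α σ r : ℝ) (l : ℕ) : IParams where
  upperNum := ⟨1 - α - r, σ, 1⟩ :: P.upperNum
  upperDen := P.upperDen
  lowerNum := ⟨1 - α - r, σ, 1⟩ :: P.lowerNum
  lowerDen := P.lowerDen ++ [⟨-l - α - r, σ, 1⟩]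

end IParams

/-- The function `k₂ x^{α-1} e^{-ax-b/x} I(δ x^σ)` on `x > 0`, extended by zero. -/
def ifigDensity (P : IParams) (α a b σ : ℝ) (δ k₂ : ℂ) (x : ℝ) : ℂ :=
  if 0 < x then
    k₂ * ((x ^ (α - 1) * Real.exp (-a * x - b * x⁻¹) : ℝ) : ℂ) *
      P.iFunction (δ * ((x ^ σ : ℝ) : ℂ))
  else 0

/-- The random variable `X` follows the `I`-function inverse Gaussian distribution. -/
structure IsIFIG {Ω : Type*} [MeasurableSpace Ω] (μ : Measure Ω) (X : Ω → ℝ)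
    (P : IParams) (α a b σ : ℝ) (δ k₂ : ℂ) : Prop where
  of_pos : 0 < α → 0 < a ∧ 0 ≤ b
  of_neg : α < 0 → 0 ≤ a ∧ 0 < b
  of_zero : α = 0 → 0 < a ∧ 0 < b
  sigma_nonneg : 0 ≤ σ
  valid : P.IsValid
  defined : P.Defined δ
  aemeasurable : AEMeasurable X μ
  density_real : ∀ x, (ifigDensity P α a b σ δ k₂ x).im = 0
  density_nonneg : ∀ x, 0 ≤ (ifigDensity P α a b σ δ k₂ x).re
  law : μ.map X =
    volume.withDensity fun x => ENNReal.ofReal (ifigDensity P α a b σ δ k₂ x).re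

/-- The standing convergence assumption for the series of the `r`-th moment: a single line is
admissible for all the `I`-functions in the series, and the integral that defines `I(δ)`
converges absolutely along it. -/
def HasMomentPath (P : IParams) (α σ : ℝ) (δ : ℂ) (r : ℝ) : Prop :=
  ∃ c : ℝ, (∀ l : ℕ, (P.momentFst α σ r l).IsPath c ∧ (P.momentSnd α σ r l).IsPath c) ∧
    P.AbsConv c δ

/-- The `l`-th term of the series for the `r`-th moment. -/
def ifigMomentTerm (P : IParams) (α a b σ : ℝ) (δ : ℂ) (r : ℝ) (l : ℕ) : ℂ :=
  (((a ^ (-α - r) : ℝ) : ℂ) * (P.momentFst α σ r l).iFunction (δ / ((a ^ σ : ℝ) : ℂ)) -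
      ((b ^ (α + r) : ℝ) : ℂ) * (P.momentSnd α σ r l).iFunction (((b ^ σ : ℝ) : ℂ) * δ)) *
    (((a * b) ^ l / l.factorial : ℝ) : ℂ)

end

/-! For `x > 0`, `x ^ r` times the density is `k₂/(2πi)` times the integral of `χ(s) δ^{-s} x^{ν-1}
e^{-ax-b/x}` over a line `Re s = c`, where `ν = α + r - σ s`. Since `|x^{ν-1}|` does not depend on
`Im s`, absolute convergence at `δ` together with convergence of the `x`-integral at one point of
the line justifies Fubini (`integral_moment_kernel`). The inner integral is of Bessel type, `∫₀^∞
x^{ν-1} e^{-ax-b/x} dx`, and for `a, b > 0` and `ν` not an integer it equals `Σ_l (ab)^l/l! ·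
Γ(ν)Γ(1-ν) (a^{-ν}/Γ(1+l-ν) - b^ν/Γ(1+l+ν))` (`hasSum_besselTerm`). Multiplying `χ` by
`Γ(ν)Γ(1-ν)/Γ(1+l∓ν)` is exactly what the added triples do, so termwise integration produces the
`T_l`. Admissibility separates the poles of `Γ(ν)` from those of `Γ(1-ν)`; hence `ν` avoids the
integers on the line and the Gamma quotients are at most `M C^l`, which `1/l!` makes summable
(`hasSum_ifigMomentTerm`).

The Bessel series needs no residue calculus. The integral is cut at `x = 1`; on `(1, ∞)` the factor
`e^{-b/x}` is expanded, leaving incomplete Gamma integrals, each a complete Gamma term minus a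
series over the poles (`expTail_eq`). The part over `(0, 1)` is the same with `(a, b, s)` replaced
by `(b, a, -s)`, and the two double series over poles cancel.

The definition of `iFunction` picks some admissible line, so independence of the line is needed.
Between two admissible lines the integrand is holomorphic with at most exponential growth, because
every factor has its argument in the right half plane, is constant, or is a natural power of the
entire function `1/Γ`. Cauchy's theorem applies after damping by `exp(ε s²)`
(`ExpGrowthOnStrip.integral_eq`). -/

noncomputable section

/-! ### Real powers of `Γ` on the right half plane. -/

/-- The logarithm, branch by branch, of Euler's product for `Γ(z)`. -/
def logGammaSeq (n : ℕ) (z : ℂ) : ℂ :=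
  z * Complex.log n + Complex.log n.factorial -
    ∑ j ∈ Finset.range (n + 1), Complex.log (z + (j : ℂ))

theorem add_natCast_ne_zero_of_re_pos {z : ℂ} (hz : 0 < z.re) (n : ℕ) : z + (n : ℂ) ≠ 0 := by
  intro h
  have h1 := congrArg Complex.re h
  simp at h1
  have : (0 : ℝ) ≤ n := n.cast_nonneg
  linarith

theorem exp_mul_logGammaSeq (κ : ℂ) {n : ℕ} (hn : n ≠ 0) {z : ℂ} (hz : 0 < z.re) :
    Complex.exp (κ * logGammaSeq n z) =
      (n : ℂ) ^ (κ * z) * (n.factorial : ℂ) ^ κ /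
        ∏ j ∈ Finset.range (n + 1), (z + (j : ℂ)) ^ κ := by
  have h1 : (n : ℂ) ≠ 0 := by exact_mod_cast hn
  have h2 : (n.factorial : ℂ) ≠ 0 := by exact_mod_cast n.factorial_ne_zero
  rw [logGammaSeq, mul_sub, mul_add, Complex.exp_sub, Complex.exp_add, Finset.mul_sum,
    Complex.exp_sum, Complex.cpow_def_of_ne_zero h1, Complex.cpow_def_of_ne_zero h2]
  congr 1
  · congr 2 <;> ring
  · refine Finset.prod_congr rfl fun j _ => ?_
    rw [Complex.cpow_def_of_ne_zero (add_natCast_ne_zero_of_re_pos hz j), mul_comm]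

/-- The terms `± z/(n+1)` cancel; they are inserted so that only remainders `log(1+w) - w = O(|w|²)`
appear, which makes the increments summable in `n`. -/
theorem logGammaSeq_succ_sub {n : ℕ} (hn : n ≠ 0) {z : ℂ} (hz : 0 < z.re) :
    logGammaSeq (n + 1) z - logGammaSeq n z =
      -z * (Complex.log (1 + -(1 / ((n : ℂ) + 1))) - -(1 / ((n : ℂ) + 1))) -
        (Complex.log (1 + z / ((n : ℂ) + 1)) - z / ((n : ℂ) + 1)) := by
  have hn0 : (0 : ℝ) < n := by positivity
  have hn1 : (0 : ℝ) < (n : ℝ) + 1 := by positivity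
  have hnc : ((n : ℂ) + 1) ≠ 0 := by exact_mod_cast hn1.ne'
  have e1 : Complex.log (((n + 1 : ℕ) : ℂ)) = (Real.log ((n : ℝ) + 1) : ℂ) := by
    rw [Complex.ofReal_log hn1.le]; push_cast; rfl
  have e2 : Complex.log (n : ℂ) = (Real.log (n : ℝ) : ℂ) := by
    rw [Complex.ofReal_log hn0.le]; push_cast; rfl
  have e3 : Complex.log (((n + 1).factorial : ℕ) : ℂ) =
      (Real.log ((n : ℝ) + 1) : ℂ) + Complex.log (n.factorial : ℂ) := by
    rw [Nat.factorial_succ, Nat.cast_mul,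
      show (((n + 1 : ℕ) : ℂ)) = (((n : ℝ) + 1 : ℝ) : ℂ) by push_cast; rfl,
      Complex.log_ofReal_mul hn1 (by exact_mod_cast n.factorial_ne_zero)]
  have e4 : Complex.log (z + ((n + 1 : ℕ) : ℂ)) =
      (Real.log ((n : ℝ) + 1) : ℂ) + Complex.log (1 + z / ((n : ℂ) + 1)) := by
    have h : z + ((n + 1 : ℕ) : ℂ) = (((n : ℝ) + 1 : ℝ) : ℂ) * (1 + z / ((n : ℂ) + 1)) := by
      push_cast; field_simp; ring
    rw [h, Complex.log_ofReal_mul hn1]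
    intro h0
    rw [h0, mul_zero] at h
    exact add_natCast_ne_zero_of_re_pos hz (n + 1) h
  have e5 : Complex.log (1 + -(1 / ((n : ℂ) + 1))) =
      (Real.log (n : ℝ) : ℂ) - (Real.log ((n : ℝ) + 1) : ℂ) := by
    rw [← Complex.ofReal_sub, ← Real.log_div hn0.ne' hn1.ne',
      Complex.ofReal_log (by positivity)]
    congr 1
    push_cast
    field_simp
    ring
  rw [logGammaSeq, logGammaSeq, Finset.sum_range_succ _ (n + 1), e1, e2, e3, e4, e5]
  ring

theorem norm_logGammaSeq_succ_sub_le {R : ℝ} {n : ℕ} (hR : 1 ≤ R)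
    (hn : 2 * R ≤ n) {z : ℂ} (hz : 0 < z.re) (hzR : ‖z‖ < R) :
    ‖logGammaSeq (n + 1) z - logGammaSeq n z‖ ≤ (R + R ^ 2) * (1 / ((n : ℝ) + 1) ^ 2) := by
  have hn0 : n ≠ 0 := by rintro rfl; norm_num at hn; linarith
  have hn1 : (0 : ℝ) < (n : ℝ) + 1 := by positivity
  have key : ∀ w : ℂ, ‖w‖ ≤ 1 / 2 → ‖Complex.log (1 + w) - w‖ ≤ ‖w‖ ^ 2 := by
    intro w hw
    refine (Complex.norm_log_one_add_sub_self_le (by linarith)).trans ?_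
    have : (1 - ‖w‖)⁻¹ ≤ 2 := by
      rw [inv_le_comm₀ (by linarith) (by norm_num)]; linarith
    nlinarith [sq_nonneg ‖w‖]
  have hnn : ‖(n : ℂ) + 1‖ = (n : ℝ) + 1 := by
    rw [show (n : ℂ) + 1 = (((n : ℝ) + 1 : ℝ) : ℂ) by push_cast; rfl, Complex.norm_real,
      Real.norm_of_nonneg hn1.le]
  have w1 : ‖-(1 / ((n : ℂ) + 1))‖ = 1 / ((n : ℝ) + 1) := by
    rw [norm_neg, norm_div, norm_one, hnn]
  have w2 : ‖z / ((n : ℂ) + 1)‖ ≤ R / ((n : ℝ) + 1) := by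
    rw [norm_div, hnn]; gcongr
  have b2 : R / ((n : ℝ) + 1) ≤ 1 / 2 := by
    rw [div_le_iff₀ hn1]; linarith
  have b1 : 1 / ((n : ℝ) + 1) ≤ 1 / 2 := le_trans (by gcongr) b2
  rw [logGammaSeq_succ_sub hn0 hz]
  refine (norm_sub_le _ _).trans ?_
  rw [norm_mul, norm_neg]
  have k1 := key _ (w1.le.trans b1)
  have k2 := key _ (w2.trans b2)
  rw [w1] at k1
  calc _ ≤ R * (1 / ((n : ℝ) + 1)) ^ 2 + (R / ((n : ℝ) + 1)) ^ 2 := by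
        gcongr
        exact k2.trans (by gcongr)
    _ = _ := by field_simp

theorem differentiableAt_logGammaSeq (n : ℕ) {z : ℂ} (hz : 0 < z.re) :
    DifferentiableAt ℂ (logGammaSeq n) z := by
  unfold logGammaSeq
  refine ((differentiableAt_id.mul_const _).add_const _).sub ?_
  refine DifferentiableAt.fun_sum fun j _ => ?_
  refine (differentiableAt_id.add_const _).clog ?_
  left
  simp
  positivity

theorem exists_tendsto_logGammaSeq (R : ℝ) (hR : 1 ≤ R) :
    ∃ g : ℂ → ℂ, DifferentiableOn ℂ g {z | 0 < z.re ∧ ‖z‖ < R} ∧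
      ∀ z : ℂ, 0 < z.re → ‖z‖ < R → Tendsto (fun n => logGammaSeq n z) atTop (𝓝 (g z)) := by
  -- From index `2R` on, `‖z/(n+1)‖ ≤ 1/2`, so the quadratic bound on the increments holds; the tail
  -- telescopes and the Weierstrass test gives a holomorphic limit.
  obtain ⟨N, hN⟩ := exists_nat_ge (2 * R)
  set U : Set ℂ := {z | 0 < z.re ∧ ‖z‖ < R} with hU
  set F : ℕ → ℂ → ℂ := fun k z => logGammaSeq (k + N + 1) z - logGammaSeq (k + N) z with hF
  set u : ℕ → ℝ := fun k => (R + R ^ 2) * (1 / (((k + N : ℕ) : ℝ) + 1) ^ 2) with hu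
  have hsum : Summable u := by
    have h1 : Summable fun k : ℕ => 1 / (k : ℝ) ^ 2 :=
      Real.summable_one_div_nat_pow.mpr (by norm_num)
    have h2 := (summable_nat_add_iff (N + 1)).mpr h1
    refine (h2.mul_left (R + R ^ 2)).congr fun k => ?_
    simp only [hu]; push_cast; ring
  have hle : ∀ k, ∀ w ∈ U, ‖F k w‖ ≤ u k := fun k w hw =>
    norm_logGammaSeq_succ_sub_le hR (hN.trans (by push_cast; linarith [k.cast_nonneg (α := ℝ)]))
      hw.1 hw.2
  have hd : ∀ k, DifferentiableOn ℂ (F k) U := fun k z hz =>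
    ((differentiableAt_logGammaSeq _ hz.1).sub
      (differentiableAt_logGammaSeq _ hz.1)).differentiableWithinAt
  have hUo : IsOpen U := (isOpen_lt continuous_const Complex.continuous_re).inter
    (isOpen_lt continuous_norm continuous_const)
  refine ⟨fun z => logGammaSeq N z + ∑' k, F k z, ?_, ?_⟩
  · exact DifferentiableOn.add
      (fun z hz => (differentiableAt_logGammaSeq _ hz.1).differentiableWithinAt)
      (Complex.differentiableOn_tsum_of_summable_norm hsum hd hUo hle)
  · intro z hz hzR
    have hs : Summable fun k => F k z :=
      Summable.of_norm_bounded hsum fun k => hle k z ⟨hz, hzR⟩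
    rw [← tendsto_add_atTop_iff_nat N]
    have := (hs.hasSum.tendsto_sum_nat).const_add (logGammaSeq N z)
    refine this.congr fun n => ?_
    have ht := Finset.sum_range_sub (fun k => logGammaSeq (k + N) z) n
    simp only [hF]
    rw [zero_add] at ht
    rw [show (∑ i ∈ Finset.range n, (logGammaSeq (i + N + 1) z - logGammaSeq (i + N) z)) =
      ∑ i ∈ Finset.range n, (logGammaSeq (i + 1 + N) z - logGammaSeq (i + N) z) from
        Finset.sum_congr rfl fun i _ => by rw [add_right_comm], ht]
    ring

/-- The holomorphic logarithm of `Γ` on the right half plane. -/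
def logGamma (z : ℂ) : ℂ := limUnder atTop fun n => logGammaSeq n z

theorem tendsto_logGammaSeq {z : ℂ} (hz : 0 < z.re) :
    Tendsto (fun n => logGammaSeq n z) atTop (𝓝 (logGamma z)) := by
  obtain ⟨g, -, hg⟩ := exists_tendsto_logGammaSeq (‖z‖ + 1) (by linarith [norm_nonneg z])
  exact tendsto_nhds_limUnder ⟨_, hg z hz (by linarith)⟩

theorem differentiableAt_logGamma {z : ℂ} (hz : 0 < z.re) : DifferentiableAt ℂ logGamma z := by
  obtain ⟨g, hd, hg⟩ := exists_tendsto_logGammaSeq (‖z‖ + 1) (by linarith [norm_nonneg z])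
  have hUo : IsOpen {w : ℂ | 0 < w.re ∧ ‖w‖ < ‖z‖ + 1} :=
    (isOpen_lt continuous_const Complex.continuous_re).inter
      (isOpen_lt continuous_norm continuous_const)
  have hmem : {w : ℂ | 0 < w.re ∧ ‖w‖ < ‖z‖ + 1} ∈ 𝓝 z := hUo.mem_nhds ⟨hz, by linarith⟩
  refine (hd.differentiableAt hmem).congr_of_eventuallyEq ?_
  filter_upwards [hmem] with w hw
  exact tendsto_nhds_unique (tendsto_logGammaSeq hw.1) (hg w hw.1 hw.2)

theorem gammaPow_eq_exp (κ : ℝ) {z : ℂ} (hz : 0 < z.re) :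
    gammaPow κ z = Complex.exp (κ * logGamma z) := by
  refine Tendsto.limUnder_eq ?_
  have h := (Complex.continuous_exp.tendsto _).comp ((tendsto_logGammaSeq hz).const_mul (κ : ℂ))
  refine h.congr' ?_
  filter_upwards [eventually_ne_atTop 0] with n hn
  exact exp_mul_logGammaSeq κ hn hz

/-- A natural power involves no branch, so `z` is arbitrary here. This matters for denominator
factors whose argument may cross the negative axis. -/
theorem gammaPow_natCast (k : ℕ) (z : ℂ) : gammaPow k z = Complex.Gamma z ^ k := by
  refine Tendsto.limUnder_eq ?_
  refine ((Complex.GammaSeq_tendsto_Gamma z).pow k).congr' ?_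
  filter_upwards [eventually_ne_atTop 0] with n hn
  have h1 : (n : ℂ) ≠ 0 := by exact_mod_cast hn
  rw [Complex.GammaSeq, div_pow, mul_pow, ← Finset.prod_pow]
  simp only [Complex.ofReal_natCast, Complex.cpow_natCast]
  rw [Complex.cpow_nat_mul]

theorem gammaPow_one (z : ℂ) : gammaPow 1 z = Complex.Gamma z := by
  simpa using gammaPow_natCast 1 z

theorem exp_logGamma {z : ℂ} (hz : 0 < z.re) : Complex.exp (logGamma z) = Complex.Gamma z := by
  rw [← gammaPow_one, gammaPow_eq_exp 1 hz]; simp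

theorem norm_gammaPow (κ : ℝ) {z : ℂ} (hz : 0 < z.re) :
    ‖gammaPow κ z‖ = ‖Complex.Gamma z‖ ^ κ := by
  rw [gammaPow_eq_exp κ hz, ← exp_logGamma hz, Complex.norm_exp, Complex.norm_exp,
    ← Real.exp_mul, Complex.re_ofReal_mul, mul_comm]

theorem differentiableAt_gammaPow (κ : ℝ) {z : ℂ} (hz : 0 < z.re) :
    DifferentiableAt ℂ (gammaPow κ) z := by
  have h : DifferentiableAt ℂ (fun w => Complex.exp (κ * logGamma w)) z :=
    ((differentiableAt_logGamma hz).const_mul _).cexp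
  refine h.congr_of_eventuallyEq ?_
  filter_upwards [(isOpen_lt continuous_const Complex.continuous_re).mem_nhds hz] with w hw
  exact gammaPow_eq_exp κ hw

theorem gammaPow_ne_zero (κ : ℝ) {z : ℂ} (hz : 0 < z.re) : gammaPow κ z ≠ 0 := by
  rw [gammaPow_eq_exp κ hz]; exact Complex.exp_ne_zero _

/-! ### Growth of `Γ` and `1/Γ` in vertical strips. -/

theorem Complex.norm_Gamma_le_Gamma_re {z : ℂ} (hz : 0 < z.re) :
    ‖Complex.Gamma z‖ ≤ Real.Gamma z.re := by
  rw [Complex.Gamma_eq_integral hz, Real.Gamma_eq_integral hz, Complex.GammaIntegral]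
  refine (norm_integral_le_integral_norm _).trans (le_of_eq ?_)
  refine setIntegral_congr_fun measurableSet_Ioi fun x hx => ?_
  have hx : 0 < x := hx
  simp only [norm_mul]
  rw [Complex.norm_cpow_eq_rpow_re_of_pos hx, Complex.norm_real, Real.norm_of_nonneg
    (Real.exp_nonneg _)]
  simp

theorem Real.continuousOn_Gamma_Ioi : ContinuousOn Real.Gamma (Set.Ioi 0) := fun x hx =>
  (Real.differentiableAt_Gamma fun m => by
    have : (0 : ℝ) ≤ m := m.cast_nonneg
    have hx : (0 : ℝ) < x := hx
    linarith).continuousAt.continuousWithinAt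

theorem exists_norm_Gamma_le {m M : ℝ} (hm : 0 < m) :
    ∃ C, 0 < C ∧ ∀ z : ℂ, m ≤ z.re → z.re ≤ M → ‖Complex.Gamma z‖ ≤ C := by
  obtain ⟨C, hC⟩ := (isCompact_Icc (a := m) (b := M)).exists_bound_of_continuousOn
    (Real.continuousOn_Gamma_Ioi.mono fun x hx => lt_of_lt_of_le hm hx.1)
  refine ⟨max C 1, by positivity, fun z h1 h2 => ?_⟩
  refine (Complex.norm_Gamma_le_Gamma_re (hm.trans_le h1)).trans ?_
  exact ((le_abs_self _).trans (hC _ ⟨h1, h2⟩)).trans (le_max_left _ _)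

theorem Complex.norm_sin_le_exp_abs_im (z : ℂ) : ‖Complex.sin z‖ ≤ Real.exp |z.im| := by
  rw [Complex.sin, norm_div, norm_mul, Complex.norm_I, mul_one]
  have h1 : ‖Complex.exp (-z * Complex.I)‖ ≤ Real.exp |z.im| := by
    rw [Complex.norm_exp]; simp [le_abs_self]
  have h2 : ‖Complex.exp (z * Complex.I)‖ ≤ Real.exp |z.im| := by
    rw [Complex.norm_exp]; simp [neg_le_abs]
  have h3 := norm_sub_le (Complex.exp (-z * Complex.I)) (Complex.exp (z * Complex.I))
  rw [div_le_iff₀ (by simp)]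
  simp only [Complex.norm_ofNat]
  linarith

/-- For `Re w ≤ 1/2` the reflection formula writes `1/Γ(w)` as `Γ(1-w) sin(πw)/π`, with `Γ(1-w)`
bounded and the sine growing like `exp(π|Im w|)`. Further right, `Γ(w) = (w-1)Γ(w-1)` with `|w-1| ≥
1` only improves the bound, so `C` does not depend on `n`. -/
theorem exists_norm_inv_Gamma_le_aux (R : ℝ) (hR : 1 ≤ R) :
    ∃ C, 0 < C ∧ ∀ n : ℕ, ∀ w : ℂ, 1 ≤ |w.im| → -R ≤ w.re → w.re ≤ 1 / 2 + n →
      ‖(Complex.Gamma w)⁻¹‖ ≤ C * Real.exp (Real.pi * |w.im|) := by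
  obtain ⟨C, hC, hCb⟩ := exists_norm_Gamma_le (m := 1 / 2) (M := 1 + R) (by norm_num)
  refine ⟨C, hC, fun n => ?_⟩
  induction n with
  | zero =>
    intro w him h1 h2
    simp only [Nat.cast_zero, add_zero] at h2
    have hw : ∀ k : ℤ, w ≠ k := fun k h => by
      rw [h] at him; norm_num at him
    have hsin : Complex.sin (Real.pi * w) ≠ 0 := by
      rw [Complex.sin_ne_zero_iff]
      intro k hk
      have : (Real.pi : ℂ) ≠ 0 := by exact_mod_cast Real.pi_ne_zero
      rw [mul_comm] at hk
      exact hw k (mul_right_cancel₀ this hk)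
    have hr := Complex.Gamma_mul_Gamma_one_sub w
    have hpi : (Real.pi : ℂ) ≠ 0 := by exact_mod_cast Real.pi_ne_zero
    have h3 : (Complex.Gamma w)⁻¹ =
        Complex.Gamma (1 - w) * Complex.sin (Real.pi * w) * (Real.pi : ℂ)⁻¹ := by
      rw [eq_div_iff hsin] at hr
      refine inv_eq_of_mul_eq_one_right ?_
      rw [← mul_assoc, ← mul_assoc, hr, mul_inv_cancel₀ hpi]
    rw [h3, norm_mul, norm_mul]
    have b1 : ‖Complex.Gamma (1 - w)‖ ≤ C := by
      apply hCb <;> simp <;> linarith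
    have b2 := Complex.norm_sin_le_exp_abs_im (Real.pi * w)
    rw [Complex.im_ofReal_mul, abs_mul, abs_of_pos Real.pi_pos] at b2
    have b3 : ‖(Real.pi : ℂ)⁻¹‖ ≤ 1 := by
      rw [norm_inv, Complex.norm_real, Real.norm_of_nonneg Real.pi_pos.le]
      exact inv_le_one_of_one_le₀ (by linarith [Real.pi_gt_three])
    calc _ ≤ C * Real.exp (Real.pi * |w.im|) * 1 := by gcongr
      _ = _ := mul_one _
  | succ n ih =>
    intro w him h1 h2
    by_cases h : w.re ≤ 1 / 2 + n
    · exact ih w him h1 h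
    · push Not at h
      have hn : (0 : ℝ) ≤ n := n.cast_nonneg
      push_cast at h2
      have hw1 : 1 ≤ ‖w - 1‖ := by
        refine le_trans ?_ (Complex.abs_im_le_norm _); simpa using him
      have hne : w - 1 ≠ 0 := norm_pos_iff.mp (by linarith)
      have hG : Complex.Gamma w = (w - 1) * Complex.Gamma (w - 1) := by
        rw [← Complex.Gamma_add_one _ hne]; ring_nf
      -- Here `Re w > 1/2`, so `Re (w - 1) > -1/2 ≥ -R` because `R ≥ 1`.
      have := ih (w - 1) (by simpa using him) (by simp; linarith) (by simp; linarith)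
      rw [hG, mul_inv, norm_mul, norm_inv]
      have h5 : ‖w - 1‖⁻¹ ≤ 1 := inv_le_one_of_one_le₀ hw1
      simp only [Complex.sub_im, Complex.one_im, sub_zero] at this
      calc _ ≤ 1 * (C * Real.exp (Real.pi * |w.im|)) := by gcongr
        _ = _ := one_mul _

theorem exists_norm_inv_Gamma_le (R : ℝ) :
    ∃ C, 0 < C ∧ ∀ w : ℂ, |w.re| ≤ R →
      ‖(Complex.Gamma w)⁻¹‖ ≤ C * Real.exp (Real.pi * |w.im|) := by
  obtain ⟨C, hC, hb⟩ := exists_norm_inv_Gamma_le_aux (max R 1) (le_max_right _ _)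
  obtain ⟨n, hn⟩ := exists_nat_ge R
  have hcomp : IsCompact (Set.Icc (-R) R ×ℂ Set.Icc (-1) 1) := isCompact_Icc.reProdIm isCompact_Icc
  obtain ⟨D, hD⟩ := hcomp.exists_bound_of_continuousOn
    Complex.differentiable_one_div_Gamma.continuous.continuousOn
  refine ⟨max C D, lt_max_of_lt_left hC, fun w hw => ?_⟩
  obtain ⟨h1, h2⟩ := abs_le.mp hw
  rcases le_total 1 |w.im| with h | h
  · refine (hb n w h ?_ (by linarith)).trans ?_
    · linarith [le_max_left R 1]
    · gcongr; exact le_max_left _ _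
  · refine (hD w ⟨⟨h1, h2⟩, abs_le.mp h⟩).trans ?_
    have : (1 : ℝ) ≤ Real.exp (Real.pi * |w.im|) := Real.one_le_exp (by positivity)
    calc D ≤ max C D := le_max_right _ _
      _ ≤ _ := le_mul_of_one_le_right (hC.le.trans (le_max_left _ _)) this

/-! ### Cauchy's theorem for functions of exponential growth on a strip. -/

/-- Holomorphic on the closed strip `c₁ ≤ Re s ≤ c₂`, with at most exponential growth in `Im s`. -/
def ExpGrowthOnStrip (c₁ c₂ : ℝ) (f : ℂ → ℂ) : Prop :=
  (∀ s : ℂ, c₁ ≤ s.re → s.re ≤ c₂ → DifferentiableAt ℂ f s) ∧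
    ∃ C K : ℝ, 0 ≤ C ∧ 0 ≤ K ∧ ∀ s : ℂ, c₁ ≤ s.re → s.re ≤ c₂ →
      ‖f s‖ ≤ C * Real.exp (K * |s.im|)

namespace ExpGrowthOnStrip

variable {c₁ c₂ : ℝ}

theorem const (w : ℂ) : ExpGrowthOnStrip c₁ c₂ fun _ => w :=
  ⟨fun _ _ _ => differentiableAt_const _, ‖w‖, 0, norm_nonneg _, le_rfl, fun _ _ _ => by simp⟩

theorem mul {f g : ℂ → ℂ} (hf : ExpGrowthOnStrip c₁ c₂ f) (hg : ExpGrowthOnStrip c₁ c₂ g) :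
    ExpGrowthOnStrip c₁ c₂ fun s => f s * g s := by
  obtain ⟨hf1, C, K, hC, hK, hf2⟩ := hf
  obtain ⟨hg1, C', K', hC', hK', hg2⟩ := hg
  refine ⟨fun s h1 h2 => (hf1 s h1 h2).mul (hg1 s h1 h2), C * C', K + K', by positivity,
    by positivity, fun s h1 h2 => ?_⟩
  rw [norm_mul, add_mul, Real.exp_add]
  calc _ ≤ (C * Real.exp (K * |s.im|)) * (C' * Real.exp (K' * |s.im|)) := by
        gcongr
        · exact hf2 s h1 h2
        · exact hg2 s h1 h2
    _ = _ := by ring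

theorem list_prod {ι : Type*} (l : List ι) (F : ι → ℂ → ℂ)
    (h : ∀ i ∈ l, ExpGrowthOnStrip c₁ c₂ (F i)) :
    ExpGrowthOnStrip c₁ c₂ fun s => (l.map fun i => F i s).prod := by
  induction l with
  | nil => simpa using const 1
  | cons i l ih =>
    simp only [List.map_cons, List.prod_cons]
    exact (h i (by simp)).mul (ih fun j hj => h j (by simp [hj]))

theorem cpow_neg {z : ℂ} (hz : z ≠ 0) : ExpGrowthOnStrip c₁ c₂ fun s => z ^ (-s) := by
  refine ⟨fun s _ _ => differentiableAt_id.neg.const_cpow (Or.inl hz),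
    Real.exp (‖Complex.log z‖ * max |c₁| |c₂|), ‖Complex.log z‖, by positivity, by positivity,
    fun s h1 h2 => ?_⟩
  beta_reduce
  rw [Complex.cpow_def_of_ne_zero hz, Complex.norm_exp, ← Real.exp_add, Real.exp_le_exp]
  refine (Complex.re_le_norm _).trans ?_
  rw [norm_mul, norm_neg, ← mul_add]
  gcongr
  exact (Complex.norm_le_abs_re_add_abs_im s).trans (by gcongr; exact abs_le_max_abs_abs h1 h2)

end ExpGrowthOnStrip

theorem re_affine_bounds {c₁ c₂ : ℝ} (u : ℂ) (v : ℝ) {s : ℂ} (h1 : c₁ ≤ s.re) (h2 : s.re ≤ c₂) :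
    min (u.re + v * c₁) (u.re + v * c₂) ≤ (u + v * s).re ∧
      (u + v * s).re ≤ max (u.re + v * c₁) (u.re + v * c₂) := by
  simp only [Complex.add_re, Complex.re_ofReal_mul]
  rcases le_total 0 v with hv | hv
  · exact ⟨(min_le_left _ _).trans (by gcongr), le_trans (by gcongr) (le_max_right _ _)⟩
  · refine ⟨(min_le_right _ _).trans ?_, le_trans ?_ (le_max_left _ _)⟩ <;> nlinarith

theorem expGrowthOnStrip_gammaPow {c₁ c₂ κ : ℝ} (hκ : 0 ≤ κ) (u : ℂ) (v : ℝ)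
    (h : v ≠ 0 → 0 < u.re + v * c₁ ∧ 0 < u.re + v * c₂) :
    ExpGrowthOnStrip c₁ c₂ fun s => gammaPow κ (u + v * s) := by
  rcases eq_or_ne v 0 with rfl | hv
  · simpa using ExpGrowthOnStrip.const (gammaPow κ u)
  obtain ⟨p1, p2⟩ := h hv
  have hm : 0 < min (u.re + v * c₁) (u.re + v * c₂) := lt_min p1 p2
  obtain ⟨C, hC, hb⟩ := exists_norm_Gamma_le (M := max (u.re + v * c₁) (u.re + v * c₂)) hm
  refine ⟨fun s h1 h2 => ?_, C ^ κ, 0, by positivity, le_rfl, fun s h1 h2 => ?_⟩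
  · have := hm.trans_le (re_affine_bounds u v h1 h2).1
    exact DifferentiableAt.comp (g := gammaPow κ) (f := fun s : ℂ => u + v * s) s
      (differentiableAt_gammaPow κ this) ((differentiableAt_id.const_mul _).const_add _)
  · obtain ⟨b1, b2⟩ := re_affine_bounds u v h1 h2
    rw [norm_gammaPow κ (hm.trans_le b1)]
    simp only [zero_mul, Real.exp_zero, mul_one]
    gcongr
    exact hb _ b1 b2

/-- For natural `κ` the function is a power of the entire function `1/Γ`, so no condition on the
position of the strip is needed. Otherwise positivity of the affine real part at both edges puts the
whole strip in the right half plane, where `gammaPow` is an exponential. -/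
theorem expGrowthOnStrip_inv_gammaPow {c₁ c₂ κ : ℝ} (hκ : 0 ≤ κ) (u : ℂ) (v : ℝ)
    (h : v ≠ 0 → (¬ ∃ k : ℕ, κ = k) → 0 < u.re + v * c₁ ∧ 0 < u.re + v * c₂) :
    ExpGrowthOnStrip c₁ c₂ fun s => (gammaPow κ (u + v * s))⁻¹ := by
  rcases eq_or_ne v 0 with rfl | hv
  · simpa using ExpGrowthOnStrip.const (gammaPow κ u)⁻¹
  obtain ⟨C, hC, hb⟩ := exists_norm_inv_Gamma_le
    (max |min (u.re + v * c₁) (u.re + v * c₂)| |max (u.re + v * c₁) (u.re + v * c₂)|)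
  have him : ∀ s : ℂ, |(u + v * s).im| ≤ |u.im| + |v| * |s.im| := fun s => by
    simp only [Complex.add_im, Complex.im_ofReal_mul, ← abs_mul]
    exact abs_add_le _ _
  have hnorm : ∀ s : ℂ, c₁ ≤ s.re → s.re ≤ c₂ → ‖Complex.Gamma (u + v * s)‖⁻¹ ^ κ ≤
      (C * Real.exp (Real.pi * |u.im|)) ^ κ * Real.exp (κ * Real.pi * |v| * |s.im|) := by
    intro s h1 h2
    obtain ⟨b1, b2⟩ := re_affine_bounds u v h1 h2
    have := hb (u + v * s) (abs_le_max_abs_abs b1 b2)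
    rw [norm_inv] at this
    have h3 : ‖Complex.Gamma (u + v * s)‖⁻¹ ≤
        (C * Real.exp (Real.pi * |u.im|)) * Real.exp (Real.pi * |v| * |s.im|) := by
      refine this.trans ?_
      rw [mul_assoc, ← Real.exp_add]
      gcongr
      have := mul_le_mul_of_nonneg_left (him s) Real.pi_pos.le
      linarith
    refine (Real.rpow_le_rpow (by positivity) h3 hκ).trans (le_of_eq ?_)
    rw [Real.mul_rpow (by positivity) (by positivity), ← Real.exp_mul]
    congr 2; ring
  have haff : ∀ s : ℂ, DifferentiableAt ℂ (fun s : ℂ => u + v * s) s := fun s =>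
    (differentiableAt_id.const_mul _).const_add _
  by_cases hk : ∃ k : ℕ, κ = k
  · obtain ⟨k, rfl⟩ := hk
    simp only [gammaPow_natCast]
    refine ⟨fun s h1 h2 => ?_, (C * Real.exp (Real.pi * |u.im|)) ^ (k : ℝ), (k : ℝ) * Real.pi * |v|,
      by positivity, by positivity, fun s h1 h2 => ?_⟩
    · have := ((Complex.differentiable_one_div_Gamma (u + v * s)).comp s (haff s)).pow k
      simpa only [Function.comp_def, Pi.pow_def, inv_pow] using this
    · have := hnorm s h1 h2
      rw [Real.rpow_natCast] at this
      rwa [norm_inv, norm_pow, ← inv_pow]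
  · obtain ⟨p1, p2⟩ := h hv hk
    have hm : 0 < min (u.re + v * c₁) (u.re + v * c₂) := lt_min p1 p2
    refine ⟨fun s h1 h2 => ?_, (C * Real.exp (Real.pi * |u.im|)) ^ κ, κ * Real.pi * |v|,
      by positivity, by positivity, fun s h1 h2 => ?_⟩
    · have := hm.trans_le (re_affine_bounds u v h1 h2).1
      exact (DifferentiableAt.comp (g := gammaPow κ) (f := fun s : ℂ => u + v * s) s
        (differentiableAt_gammaPow κ this) (haff s)).inv (gammaPow_ne_zero κ this)
    · have h0 := hm.trans_le (re_affine_bounds u v h1 h2).1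
      have := hnorm s h1 h2
      rwa [norm_inv, norm_gammaPow κ h0, ← Real.inv_rpow (norm_nonneg _)]

/-- Cauchy's theorem on a vertical strip for functions of exponential growth that are absolutely
integrable on the two boundary lines. -/
theorem ExpGrowthOnStrip.integral_eq {c₁ c₂ : ℝ} {f : ℂ → ℂ} (hf : ExpGrowthOnStrip c₁ c₂ f)
    (hc : c₁ ≤ c₂) (i₁ : Integrable fun t : ℝ => f (c₁ + t * Complex.I))
    (i₂ : Integrable fun t : ℝ => f (c₂ + t * Complex.I)) :
    ∫ t : ℝ, f (c₁ + t * Complex.I) = ∫ t : ℝ, f (c₂ + t * Complex.I) := by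
  obtain ⟨hd, C, K, hC, hK, hb⟩ := hf
  set M := max |c₁| |c₂| with hM
  have hnorm : ∀ (ε : ℝ) (s : ℂ),
      ‖Complex.exp (ε * s ^ 2)‖ = Real.exp (ε * (s.re ^ 2 - s.im ^ 2)) := by
    intro ε s
    rw [Complex.norm_exp, Complex.re_ofReal_mul]
    congr 2
    rw [sq, Complex.mul_re]; ring
  have hcont : ∀ (ε c : ℝ), Continuous fun t : ℝ =>
      Complex.exp (ε * ((c : ℂ) + t * Complex.I) ^ 2) := fun ε c => by fun_prop
  -- The real part of `ε s²` is `ε(c² - t²) ≤ c²`, a bound uniform in `ε`, which later dominates the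
  -- limit `ε → 0`.
  have hle : ∀ (ε c t : ℝ), 0 ≤ ε → ε ≤ 1 →
      ‖Complex.exp (ε * ((c : ℂ) + t * Complex.I) ^ 2)‖ ≤ Real.exp (c ^ 2) := by
    intro ε c t h0 h1
    rw [hnorm, Real.exp_le_exp]
    simp
    nlinarith [sq_nonneg c, sq_nonneg t, mul_nonneg h0 (sq_nonneg t),
      mul_nonneg (sub_nonneg.mpr h1) (sq_nonneg c)]
  have hint : ∀ (ε c : ℝ), 0 ≤ ε → ε ≤ 1 → Integrable (fun t : ℝ => f (c + t * Complex.I)) →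
      Integrable fun t : ℝ =>
        Complex.exp (ε * ((c : ℂ) + t * Complex.I) ^ 2) * f (c + t * Complex.I) := by
    intro ε c h0 h1 hi
    exact hi.bdd_mul (c := Real.exp (c ^ 2)) (hcont ε c).aestronglyMeasurable
      (Eventually.of_forall fun t => hle ε c t h0 h1)
  have hlim0 : ∀ (c : ℝ), Integrable (fun t : ℝ => f (c + t * Complex.I)) →
      Tendsto (fun n : ℕ => ∫ t : ℝ, Complex.exp (((1 / ((n : ℝ) + 1) : ℝ) : ℂ) *
        ((c : ℂ) + t * Complex.I) ^ 2) * f (c + t * Complex.I)) atTop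
        (𝓝 (∫ t : ℝ, f (c + t * Complex.I))) := by
    intro c hi
    have hε : ∀ n : ℕ, 1 / ((n : ℝ) + 1) ≤ 1 := fun n => by
      rw [div_le_one (by positivity)]; linarith [n.cast_nonneg (α := ℝ)]
    refine tendsto_integral_of_dominated_convergence
      (fun t => Real.exp (c ^ 2) * ‖f (c + t * Complex.I)‖)
      (fun n => (hint _ c (by positivity) (hε n) hi).aestronglyMeasurable)
      (hi.norm.const_mul _) (fun n => Eventually.of_forall fun t => ?_)
      (Eventually.of_forall fun t => ?_)
    · rw [norm_mul]
      gcongr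
      exact hle _ c t (by positivity) (hε n)
    · have h1 : Tendsto (fun n : ℕ => ((1 / ((n : ℝ) + 1) : ℝ) : ℂ)) atTop (𝓝 ((0 : ℝ) : ℂ)) :=
        (Complex.continuous_ofReal.tendsto _).comp tendsto_one_div_add_atTop_nhds_zero_nat
      have h2 := ((Complex.continuous_exp.tendsto _).comp
        (h1.mul_const (((c : ℂ) + t * Complex.I) ^ 2))).mul_const (f (c + t * Complex.I))
      simpa [Function.comp_def] using h2
  -- With damping, the horizontal sides of the rectangle are of size `exp(KT - εT²)`, which tends to
  -- `0` whatever the growth rate `K`.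
  have key : ∀ ε : ℝ, 0 < ε → ε ≤ 1 →
      ∫ t : ℝ, Complex.exp (ε * ((c₁ : ℂ) + t * Complex.I) ^ 2) * f (c₁ + t * Complex.I) =
      ∫ t : ℝ, Complex.exp (ε * ((c₂ : ℂ) + t * Complex.I) ^ 2) * f (c₂ + t * Complex.I) := by
    intro ε h0 h1
    set g : ℂ → ℂ := fun s => Complex.exp (ε * s ^ 2) * f s with hg
    have hgd : ∀ s : ℂ, c₁ ≤ s.re → s.re ≤ c₂ → DifferentiableAt ℂ g s := fun s a b =>
      (((differentiableAt_id.pow 2).const_mul _).cexp).mul (hd s a b)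
    have hgb : ∀ (x y : ℝ), c₁ ≤ x → x ≤ c₂ → ‖g (x + y * Complex.I)‖ ≤
        C * Real.exp (ε * M ^ 2) * Real.exp (K * |y| - ε * y ^ 2) := by
      intro x y a b
      have h := hb (x + y * Complex.I) (by simpa using a) (by simpa using b)
      have hx : x ^ 2 ≤ M ^ 2 := by
        rw [← sq_abs x]
        gcongr
        exact abs_le_max_abs_abs a b
      rw [hg, norm_mul, hnorm]
      simp only [Complex.add_im, Complex.ofReal_im, Complex.mul_im, Complex.ofReal_re,
        Complex.I_im, mul_one, Complex.I_re, mul_zero, add_zero, zero_add, Complex.add_re,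
        Complex.mul_re, sub_self] at h ⊢
      calc _ ≤ Real.exp (ε * (M ^ 2 - y ^ 2)) * (C * Real.exp (K * |y|)) := by gcongr
        _ = _ := by
          rw [mul_assoc C, ← Real.exp_add, mul_left_comm, ← Real.exp_add]
          congr 2; ring
    have hside : ∀ T : ℝ, 0 ≤ T →
        ‖(∫ x in c₁..c₂, g (x + ((-T : ℝ) : ℂ) * Complex.I)) -
          ∫ x in c₁..c₂, g (x + (T : ℂ) * Complex.I)‖ ≤
        2 * (C * Real.exp (ε * M ^ 2) * |c₂ - c₁|) * Real.exp (K * T - ε * T ^ 2) := by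
      intro T hT
      have hb1 : ∀ y : ℝ, |y| = T → ‖∫ x in c₁..c₂, g (x + (y : ℂ) * Complex.I)‖ ≤
          C * Real.exp (ε * M ^ 2) * Real.exp (K * T - ε * T ^ 2) * |c₂ - c₁| := by
        intro y hy
        refine intervalIntegral.norm_integral_le_of_norm_le_const fun x hx => ?_
        rw [Set.uIoc_of_le hc] at hx
        have := hgb x y hx.1.le hx.2
        rwa [hy, ← sq_abs y, hy] at this
      refine (norm_sub_le _ _).trans ((add_le_add (hb1 (-T) (by rw [abs_neg, abs_of_nonneg hT]))
        (hb1 T (abs_of_nonneg hT))).trans (le_of_eq (by ring)))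
    have hrect : ∀ T : ℝ, 0 ≤ T →
        ‖(∫ y in (-T)..T, g (c₁ + y * Complex.I)) - ∫ y in (-T)..T, g (c₂ + y * Complex.I)‖ ≤
        2 * (C * Real.exp (ε * M ^ 2) * |c₂ - c₁|) * Real.exp (K * T - ε * T ^ 2) := by
      intro T hT
      have := Complex.integral_boundary_rect_eq_zero_of_differentiableOn g ⟨c₁, -T⟩ ⟨c₂, T⟩ (by
        intro s hs
        have := hs.1
        simp only [Set.mem_preimage, Set.uIcc_of_le hc] at this
        exact (hgd s this.1 this.2).differentiableWithinAt)
      dsimp only at this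
      refine le_trans (le_of_eq ?_) (hside T hT)
      rw [← one_mul ‖(∫ y in (-T)..T, g (c₁ + y * Complex.I)) - _‖, ← Complex.norm_I, ← norm_mul]
      congr 1
      simp only [smul_eq_mul] at this
      linear_combination -this
    have hexp : Tendsto (fun n : ℕ => 2 * (C * Real.exp (ε * M ^ 2) * |c₂ - c₁|) *
        Real.exp (K * n - ε * (n : ℝ) ^ 2)) atTop (𝓝 0) := by
      have h1 : Tendsto (fun n : ℕ => K * n - ε * (n : ℝ) ^ 2) atTop atBot := by
        have h2 : Tendsto (fun n : ℕ => (n : ℝ)) atTop atTop := tendsto_natCast_atTop_atTop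
        have h3 : Tendsto (fun n : ℕ => K - ε * (n : ℝ)) atTop atBot := by
          simpa [sub_eq_add_neg] using
            tendsto_atBot_add_const_left atTop K
              (tendsto_neg_atTop_atBot.comp (h2.const_mul_atTop h0))
        refine (h2.atTop_mul_atBot₀ h3).congr fun n => by ring
      simpa using (Real.tendsto_exp_atBot.comp h1).const_mul
        (2 * (C * Real.exp (ε * M ^ 2) * |c₂ - c₁|))
    have ht : Tendsto (fun n : ℕ => -(n : ℝ)) atTop atBot :=
      tendsto_neg_atTop_atBot.comp tendsto_natCast_atTop_atTop
    have t1 := intervalIntegral_tendsto_integral (hint ε c₁ h0.le h1 i₁) ht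
      tendsto_natCast_atTop_atTop
    have t2 := intervalIntegral_tendsto_integral (hint ε c₂ h0.le h1 i₂) ht
      tendsto_natCast_atTop_atTop
    have t3 := squeeze_zero_norm (fun n : ℕ => hrect n n.cast_nonneg) hexp
    exact sub_eq_zero.mp (tendsto_nhds_unique (t1.sub t2) t3)
  refine tendsto_nhds_unique (hlim0 c₁ i₁)
    ((hlim0 c₂ i₂).congr fun n => (key _ (by positivity) ?_).symm)
  rw [div_le_one (by positivity)]; linarith [n.cast_nonneg (α := ℝ)]

/-! ### Independence of the Mellin-Barnes integral from the admissible line. -/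

namespace IParams

/-- All scales and exponents are nonnegative. -/
def IsNonneg (P : IParams) : Prop :=
  ∀ t ∈ P.upperNum ++ P.upperDen ++ P.lowerNum ++ P.lowerDen, 0 ≤ t.scale ∧ 0 ≤ t.power

theorem IsPath.re_upperNum_pos {P : IParams} {c : ℝ} (h : P.IsPath c) {t : IFactor}
    (ht : t ∈ P.upperNum) (hs : 0 < t.scale) : 0 < (1 - t.coef).re - t.scale * c := by
  by_contra hcon
  push Not at hcon
  have hs' : (t.scale : ℂ) ≠ 0 := by exact_mod_cast hs.ne'
  have := h.right t ht ((1 - t.coef) / t.scale) 0 (by field_simp; simp)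
  rw [Complex.div_ofReal_re, lt_div_iff₀ hs] at this
  linarith

theorem IsPath.re_lowerNum_pos {P : IParams} {c : ℝ} (h : P.IsPath c) {t : IFactor}
    (ht : t ∈ P.lowerNum) (hs : 0 < t.scale) : 0 < t.coef.re + t.scale * c := by
  by_contra hcon
  push Not at hcon
  have hs' : (t.scale : ℂ) ≠ 0 := by exact_mod_cast hs.ne'
  have := h.left t ht (-t.coef / t.scale) 0 (by field_simp; simp)
  rw [Complex.div_ofReal_re, div_lt_iff₀ hs] at this
  simp at this
  linarith

/-- As `s` runs along the line, `u + v s` covers a full vertical line and so meets the real axis;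
avoiding the cut there means that its constant real part is positive. -/
theorem re_pos_of_forall_mem_slitPlane {u : ℂ} {v c : ℝ} (hv : v ≠ 0)
    (h : ∀ s : ℂ, s.re = c → u + v * s ∈ Complex.slitPlane) : 0 < u.re + v * c := by
  have := h (c + ((-u.im / v : ℝ) : ℂ) * Complex.I) (by simp)
  rw [Complex.mem_slitPlane_iff] at this
  have him : (u + v * ((c : ℂ) + ((-u.im / v : ℝ) : ℂ) * Complex.I)).im = 0 := by
    simp; field_simp; ring
  rcases this with h | h
  · simpa using h
  · exact absurd him h

theorem expGrowthOnStrip_chi_mul_cpow {P : IParams} (hP : P.IsNonneg) {c₁ c₂ : ℝ}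
    (h1 : P.IsPath c₁) (h2 : P.IsPath c₂) {z : ℂ} (hz : z ≠ 0) :
    ExpGrowthOnStrip c₁ c₂ fun s => P.chi s * z ^ (-s) := by
  have hneg : ∀ (t : IFactor) (s : ℂ),
      1 - t.coef - t.scale * s = (1 - t.coef) + ((-t.scale : ℝ) : ℂ) * s := fun t s => by
    push_cast; ring
  have hchi : P.chi = fun s =>
      ((P.upperNum.map fun t => gammaPow t.power (1 - t.coef - t.scale * s)).prod *
        (P.lowerNum.map fun t => gammaPow t.power (t.coef + t.scale * s)).prod) *
      ((P.upperDen.map fun t => (gammaPow t.power (t.coef + t.scale * s))⁻¹).prod *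
        (P.lowerDen.map fun t => (gammaPow t.power (1 - t.coef - t.scale * s))⁻¹).prod) := by
    funext s
    rw [chi, div_eq_mul_inv, mul_inv, List.prod_inv, List.prod_inv, List.map_map, List.map_map]
    rfl
  have hpos : ∀ t ∈ P.upperNum ++ P.upperDen ++ P.lowerNum ++ P.lowerDen, t.scale ≠ 0 →
      0 < t.scale := fun t ht h0 => lt_of_le_of_ne (hP t ht).1 h0.symm
  rw [hchi]
  refine ((ExpGrowthOnStrip.mul ?_ ?_).mul (ExpGrowthOnStrip.mul ?_ ?_)).mul
    (ExpGrowthOnStrip.cpow_neg hz)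
  · refine ExpGrowthOnStrip.list_prod _
      (fun (t : IFactor) s => gammaPow t.power (1 - t.coef - t.scale * s)) fun t ht => ?_
    have hm : t ∈ P.upperNum ++ P.upperDen ++ P.lowerNum ++ P.lowerDen := by simp [ht]
    simp only [hneg]
    refine expGrowthOnStrip_gammaPow (hP t hm).2 _ _ fun h0 => ?_
    have h0 := hpos t hm (neg_ne_zero.mp h0)
    have e1 := h1.re_upperNum_pos ht h0
    have e2 := h2.re_upperNum_pos ht h0
    constructor <;> linarith
  · refine ExpGrowthOnStrip.list_prod _
      (fun (t : IFactor) s => gammaPow t.power (t.coef + t.scale * s)) fun t ht => ?_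
    have hm : t ∈ P.upperNum ++ P.upperDen ++ P.lowerNum ++ P.lowerDen := by simp [ht]
    exact expGrowthOnStrip_gammaPow (hP t hm).2 _ _ fun h0 =>
      ⟨h1.re_lowerNum_pos ht (hpos t hm h0), h2.re_lowerNum_pos ht (hpos t hm h0)⟩
  · refine ExpGrowthOnStrip.list_prod _
      (fun (t : IFactor) s => (gammaPow t.power (t.coef + t.scale * s))⁻¹) fun t ht => ?_
    have hm : t ∈ P.upperNum ++ P.upperDen ++ P.lowerNum ++ P.lowerDen := by simp [ht]
    exact expGrowthOnStrip_inv_gammaPow (hP t hm).2 _ _ fun h0 hk =>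
      ⟨re_pos_of_forall_mem_slitPlane h0 (h1.cut_upper t ht hk),
        re_pos_of_forall_mem_slitPlane h0 (h2.cut_upper t ht hk)⟩
  · refine ExpGrowthOnStrip.list_prod _
      (fun (t : IFactor) s => (gammaPow t.power (1 - t.coef - t.scale * s))⁻¹) fun t ht => ?_
    have hm : t ∈ P.upperNum ++ P.upperDen ++ P.lowerNum ++ P.lowerDen := by simp [ht]
    have e1 := h1.cut_lower t ht
    have e2 := h2.cut_lower t ht
    simp only [hneg] at e1 e2 ⊢
    exact expGrowthOnStrip_inv_gammaPow (hP t hm).2 _ _ fun h0 hk =>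
      ⟨re_pos_of_forall_mem_slitPlane h0 (e1 hk), re_pos_of_forall_mem_slitPlane h0 (e2 hk)⟩

theorem barnesIntegral_eq_of_le {P : IParams} (hP : P.IsNonneg) {c₁ c₂ : ℝ} (hc : c₁ ≤ c₂)
    (h1 : P.IsPath c₁) (h2 : P.IsPath c₂) {z : ℂ} (hz : z ≠ 0) (a1 : P.AbsConv c₁ z)
    (a2 : P.AbsConv c₂ z) : P.barnesIntegral c₁ z = P.barnesIntegral c₂ z := by
  have := (expGrowthOnStrip_chi_mul_cpow hP h1 h2 hz).integral_eq hc a1 a2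
  simp only [barnesIntegral, integral_mul_const, integrand]
  rw [this]

theorem iFunction_eq_barnesIntegral {P : IParams} (hP : P.IsNonneg) {c : ℝ} (h : P.IsPath c)
    {z : ℂ} (hz : z ≠ 0) (a : P.AbsConv c z) : P.iFunction z = P.barnesIntegral c z := by
  have hd : P.Defined z := ⟨hz, c, h, a⟩
  obtain ⟨h', a'⟩ := hd.2.choose_spec
  rw [iFunction, dif_pos hd]
  rcases le_total hd.2.choose c with hc | hc
  · exact barnesIntegral_eq_of_le hP hc h' h hz a' a
  · exact (barnesIntegral_eq_of_le hP hc h h' hz a a').symm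

end IParams

/-! ### The incomplete Gamma integral and its expansion over poles. -/

theorem exists_norm_inv_add_intCast_le (ν : ℂ) :
    ∃ C, 0 ≤ C ∧ ∀ m : ℤ, ‖(ν + (m : ℂ))⁻¹‖ ≤ C := by
  obtain ⟨N, hN⟩ := exists_nat_ge (‖ν‖ + 1)
  obtain ⟨C, hC⟩ := ((Set.finite_Icc (-(N : ℤ)) N).image
    fun m : ℤ => ‖(ν + (m : ℂ))⁻¹‖).bddAbove
  -- Outside the finite window `|ν + m| ≥ 1`. An integer `ν` does no harm, since the inverse of `0`
  -- is `0`.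
  refine ⟨max C 1, by positivity, fun m => ?_⟩
  by_cases hm : m ∈ Set.Icc (-(N : ℤ)) N
  · exact (hC ⟨m, hm, rfl⟩).trans (le_max_left _ _)
  · refine le_trans ?_ (le_max_right _ _)
    have h1 : (N : ℤ) ≤ |m| := by
      rw [Set.mem_Icc] at hm
      by_contra h
      push Not at h
      exact hm (abs_le.mp h.le)
    have h2 : (N : ℝ) ≤ ‖(m : ℂ)‖ := by
      rw [Complex.norm_intCast]; exact_mod_cast h1
    have h3 := norm_sub_norm_le (m : ℂ) (-ν)
    rw [norm_neg, sub_neg_eq_add, add_comm (m : ℂ)] at h3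
    rw [norm_inv]
    exact inv_le_one_of_one_le₀ (by linarith)

theorem summable_pow_div_factorial_mul_inv (a : ℝ) (s : ℂ) :
    Summable fun k : ℕ => (-a : ℂ) ^ k / k.factorial * (s + k)⁻¹ := by
  obtain ⟨C, hC, hb⟩ := exists_norm_inv_add_intCast_le s
  refine Summable.of_norm_bounded ((Real.summable_pow_div_factorial |a|).mul_right C) fun k => ?_
  rw [norm_mul, norm_div, norm_pow, norm_neg, Complex.norm_real, Complex.norm_natCast,
    Real.norm_eq_abs]
  gcongr
  simpa using hb k

theorem integrableOn_cpow_mul_exp_neg_mul_Ioi_one {a : ℝ} (ha : 0 < a) (s : ℂ) :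
    IntegrableOn (fun x : ℝ => (x : ℂ) ^ (s - 1) * (Real.exp (-a * x) : ℂ)) (Set.Ioi 1) := by
  have h1 : IntegrableOn (fun x : ℝ => x ^ (s - 1).re * Real.exp (-a * x)) (Set.Ioi 1) := by
    refine integrable_of_isBigO_exp_neg (half_pos ha) ?_ ?_
    · refine ContinuousOn.mul (fun x hx => ?_) (by fun_prop)
      have hx : (1 : ℝ) ≤ x := hx
      exact (Real.continuousAt_rpow_const x _ (Or.inl (by linarith))).continuousWithinAt
    · have h := (isLittleO_rpow_exp_pos_mul_atTop (s - 1).re (half_pos ha)).isBigO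
      refine (h.mul (Asymptotics.isBigO_refl (fun x : ℝ => Real.exp (-a * x)) atTop)).congr_right
        fun x => ?_
      rw [← Real.exp_add]
      congr 1; ring
  refine Integrable.mono' h1 (ContinuousOn.aestronglyMeasurable (fun x hx => ?_)
    measurableSet_Ioi) ?_
  · have hx : (1 : ℝ) < x := hx
    exact ((Complex.continuousAt_ofReal_cpow_const x (s - 1) (Or.inr (by linarith))).mul
      (by fun_prop)).continuousWithinAt
  · filter_upwards [ae_restrict_mem measurableSet_Ioi] with x hx
    have hx : (1 : ℝ) < x := hx
    rw [norm_mul, Complex.norm_cpow_eq_rpow_re_of_pos (by linarith), Complex.norm_real,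
      Real.norm_of_nonneg (Real.exp_nonneg _)]

/-- The upper incomplete Gamma function, up to scaling. -/
def expTail (a : ℝ) (s : ℂ) : ℂ :=
  ∫ x in Set.Ioi (1 : ℝ), (x : ℂ) ^ (s - 1) * (Real.exp (-a * x) : ℂ)

/-- Integration by parts: `x^s e^{-ax}` vanishes at infinity and equals `e^{-a}` at `1`. -/
theorem expTail_add_one {a : ℝ} (ha : 0 < a) (s : ℂ) :
    a * expTail a (s + 1) = Real.exp (-a) + s * expTail a s := by
  have i1 := (integrableOn_cpow_mul_exp_neg_mul_Ioi_one ha s).const_mul s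
  have i2 := (integrableOn_cpow_mul_exp_neg_mul_Ioi_one ha (s + 1)).const_mul (a : ℂ)
  have hderiv : ∀ x ∈ Set.Ici (1 : ℝ), HasDerivAt
      (fun x : ℝ => (x : ℂ) ^ s * (Real.exp (-a * x) : ℂ))
      (s * ((x : ℂ) ^ (s - 1) * (Real.exp (-a * x) : ℂ)) -
        a * ((x : ℂ) ^ (s + 1 - 1) * (Real.exp (-a * x) : ℂ))) x := by
    intro x hx
    have hx : (1 : ℝ) ≤ x := hx
    have d1 : HasDerivAt (fun x : ℝ => (x : ℂ) ^ s) (s * (x : ℂ) ^ (s - 1)) x := by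
      have := (hasDerivAt_id (x : ℂ)).cpow_const (c := s)
        (Or.inl (show 0 < ((x : ℂ)).re by simp; linarith))
      simpa using this.comp_ofReal
    have d2 : HasDerivAt (fun x : ℝ => (Real.exp (-a * x) : ℂ))
        ((Real.exp (-a * x) * (-a) : ℝ) : ℂ) x := by
      refine HasDerivAt.ofReal_comp ?_
      simpa using ((hasDerivAt_id x).const_mul (-a)).exp
    convert! d1.mul d2 using 1
    rw [add_sub_cancel_right]
    push_cast
    ring
  have hlim : Tendsto (fun x : ℝ => (x : ℂ) ^ s * (Real.exp (-a * x) : ℂ)) atTop (𝓝 0) := by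
    rw [tendsto_zero_iff_norm_tendsto_zero]
    refine (tendsto_rpow_mul_exp_neg_mul_atTop_nhds_zero s.re a ha).congr' ?_
    filter_upwards [eventually_gt_atTop 0] with x hx
    rw [norm_mul, Complex.norm_cpow_eq_rpow_re_of_pos hx, Complex.norm_real,
      Real.norm_of_nonneg (Real.exp_nonneg _)]
  have := integral_Ioi_of_hasDerivAt_of_tendsto' hderiv (i1.sub i2) hlim
  rw [integral_sub i1 i2, integral_const_mul, integral_const_mul] at this
  simp only [Complex.ofReal_one, Complex.one_cpow, mul_one, one_mul] at this
  unfold expTail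
  linear_combination -this

theorem integral_cpow_mul_exp_Ioc {a : ℝ} (ha : 0 < a) {s : ℂ} (hs : 0 < s.re) :
    ∫ x in Set.Ioc (0 : ℝ) 1, (x : ℂ) ^ (s - 1) * (Real.exp (-a * x) : ℂ) =
      ∑' k : ℕ, (-a : ℂ) ^ k / k.factorial * (s + k)⁻¹ := by
  have hre : ∀ k : ℕ, -1 < (s + k - 1).re := fun k => by
    simp; linarith [k.cast_nonneg (α := ℝ)]
  have hint : ∀ k : ℕ, IntegrableOn (fun x : ℝ =>
      (-a : ℂ) ^ k / k.factorial * (x : ℂ) ^ (s + k - 1))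
      (Set.Ioc 0 1) := fun k => by
    have := intervalIntegral.intervalIntegrable_cpow' (a := 0) (b := 1) (hre k)
    rw [intervalIntegrable_iff_integrableOn_Ioc_of_le zero_le_one] at this
    exact this.const_mul _
  have hval : ∀ k : ℕ, ∫ x in Set.Ioc (0 : ℝ) 1,
      (-a : ℂ) ^ k / k.factorial * (x : ℂ) ^ (s + k - 1) =
      (-a : ℂ) ^ k / k.factorial * (s + k)⁻¹ := fun k => by
    rw [integral_const_mul, ← intervalIntegral.integral_of_le zero_le_one,
      integral_cpow (Or.inl (hre k))]
    have h0 : s + k ≠ 0 := fun h => by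
      have := congrArg Complex.re h
      simp at this
      linarith [k.cast_nonneg (α := ℝ)]
    simp [h0]
  have hnorm : Summable fun k : ℕ =>
      ∫ x in Set.Ioc (0 : ℝ) 1, ‖(-a : ℂ) ^ k / k.factorial * (x : ℂ) ^ (s + k - 1)‖ := by
    refine Summable.of_nonneg_of_le (fun k => integral_nonneg fun x => norm_nonneg _) (fun k => ?_)
      ((Real.summable_pow_div_factorial a).mul_right
        (∫ x in Set.Ioc (0 : ℝ) 1, ‖(x : ℂ) ^ (s - 1)‖))
    rw [← integral_const_mul]
    have i0 : IntegrableOn (fun x : ℝ => (x : ℂ) ^ (s - 1)) (Set.Ioc 0 1) := by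
      have := hint 0; simpa [IntegrableOn] using this
    refine setIntegral_mono_on (hint k).norm (i0.norm.const_mul _) measurableSet_Ioc fun x hx => ?_
    rw [norm_mul, norm_div, norm_pow, norm_neg, Complex.norm_real, Complex.norm_natCast,
      Real.norm_of_nonneg ha.le, Complex.norm_cpow_eq_rpow_re_of_pos hx.1,
      Complex.norm_cpow_eq_rpow_re_of_pos hx.1]
    gcongr ?_ * ?_
    exact Real.rpow_le_rpow_of_exponent_ge hx.1 hx.2 (by simp)
  have h := hasSum_integral_of_summable_integral_norm hint hnorm
  simp only [hval] at h
  rw [h.tsum_eq]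
  refine setIntegral_congr_fun measurableSet_Ioc fun x hx => ?_
  have hx0 : (x : ℂ) ≠ 0 := by exact_mod_cast hx.1.ne'
  have he : (Real.exp (-a * x) : ℂ) = ∑' k : ℕ, (-a * x : ℂ) ^ k / k.factorial := by
    rw [Complex.ofReal_exp, Complex.exp_eq_exp_ℂ, NormedSpace.exp_eq_tsum_div]
    push_cast; rfl
  rw [he, ← tsum_mul_left]
  refine tsum_congr fun k => ?_
  rw [add_sub_right_comm, Complex.cpow_add _ _ hx0, Complex.cpow_natCast, mul_pow]
  ring

theorem integrableOn_cpow_mul_exp_neg_mul_Ioc (a : ℝ) {s : ℂ} (hs : 0 < s.re) :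
    IntegrableOn (fun x : ℝ => (x : ℂ) ^ (s - 1) * (Real.exp (-a * x) : ℂ)) (Set.Ioc 0 1) := by
  have := intervalIntegral.intervalIntegrable_cpow' (a := 0) (b := 1) (r := s - 1)
    (by simpa using hs)
  rw [intervalIntegrable_iff_integrableOn_Ioc_of_le zero_le_one] at this
  exact this.mul_continuousOn_of_subset (K := Set.Icc 0 1) (by fun_prop)
    measurableSet_Ioc isCompact_Icc Set.Ioc_subset_Icc_self

/-- For `Re s > 0` this is the complete Gamma integral minus its part over `(0, 1]`, integrated term
by term. Both sides satisfy the recursion of `expTail_add_one`, which carries the identity leftwards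
one unit at a time. -/
theorem expTail_eq {a : ℝ} (ha : 0 < a) {s : ℂ} (hs : ∀ k : ℕ, s + k ≠ 0) :
    expTail a s = (a : ℂ) ^ (-s) * Complex.Gamma s -
      ∑' k : ℕ, (-a : ℂ) ^ k / k.factorial * (s + k)⁻¹ := by
  have hac : (a : ℂ) ≠ 0 := by exact_mod_cast ha.ne'
  obtain ⟨n, hn⟩ : ∃ n : ℕ, -(n : ℝ) < s.re := by
    obtain ⟨n, hn⟩ := exists_nat_gt (-s.re)
    exact ⟨n, by linarith⟩
  induction n generalizing s with
  | zero =>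
    have hs0 : 0 < s.re := by simpa using hn
    have h1 := Complex.integral_cpow_mul_exp_neg_mul_Ioi hs0 ha
    have h2 : ∀ x : ℝ, Complex.exp (-((a : ℂ) * x)) = (Real.exp (-a * x) : ℂ) := fun x => by
      push_cast; ring_nf
    simp only [h2] at h1
    have i1 := integrableOn_cpow_mul_exp_neg_mul_Ioc a hs0
    rw [← Set.Ioc_union_Ioi_eq_Ioi (zero_le_one (α := ℝ)),
      setIntegral_union (Set.Ioc_disjoint_Ioi le_rfl) measurableSet_Ioi i1
        (integrableOn_cpow_mul_exp_neg_mul_Ioi_one ha s),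
      integral_cpow_mul_exp_Ioc ha hs0] at h1
    rw [expTail, eq_sub_iff_add_eq', h1, one_div, Complex.cpow_neg,
      Complex.inv_cpow _ _ (by rw [Complex.arg_ofReal_of_nonneg ha.le]; exact Real.pi_pos.ne)]
  | succ n ih =>
    have hs0 : s ≠ 0 := by simpa using hs 0
    have h1 := ih (s := s + 1) (fun k => by
      simpa [add_assoc, add_comm, add_left_comm] using hs (k + 1)) (by
      push_cast at hn; simp; linarith)
    have h2 := expTail_add_one ha s
    rw [h1, Complex.Gamma_add_one s hs0] at h2
    have hexp : (Real.exp (-a) : ℂ) = ∑' k : ℕ, (-a : ℂ) ^ k / k.factorial := by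
      rw [Complex.ofReal_exp, Complex.exp_eq_exp_ℂ, NormedSpace.exp_eq_tsum_div]
      push_cast; rfl
    have hse : Summable fun k : ℕ => (-a : ℂ) ^ k / k.factorial := by
      have := NormedSpace.expSeries_div_summable (-a : ℂ); simpa using this
    -- By `1 - s/(s+k) = k/(s+k)`, the right side loses its term `k = 0`, and the index shift turns
    -- it into the left side.
    have hsum : -(a : ℂ) * ∑' k : ℕ, (-a : ℂ) ^ k / k.factorial * (s + 1 + k)⁻¹ =
        Real.exp (-a) - s * ∑' k : ℕ, (-a : ℂ) ^ k / k.factorial * (s + k)⁻¹ := by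
      rw [hexp, ← tsum_mul_left, ← tsum_mul_left, ← hse.tsum_sub
        ((summable_pow_div_factorial_mul_inv a s).mul_left s)]
      have hsub : Summable fun k : ℕ => (-a : ℂ) ^ k / k.factorial -
          s * ((-a : ℂ) ^ k / k.factorial * (s + k)⁻¹) :=
        hse.sub ((summable_pow_div_factorial_mul_inv a s).mul_left s)
      rw [hsub.tsum_eq_zero_add]
      have h0 : (-a : ℂ) ^ 0 / (Nat.factorial 0 : ℂ) -
          s * ((-a : ℂ) ^ 0 / (Nat.factorial 0 : ℂ) * (s + ((0 : ℕ) : ℂ))⁻¹) = 0 := by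
        simp [hs0]
      rw [h0, zero_add]
      refine tsum_congr fun k => ?_
      have hk := hs (k + 1)
      have hk' : s + 1 + k ≠ 0 := by
        convert! hk using 1; push_cast; ring
      have hf : (k.factorial : ℂ) ≠ 0 := by exact_mod_cast k.factorial_ne_zero
      have hk1 : (k : ℂ) + 1 ≠ 0 := by exact_mod_cast k.succ_ne_zero
      rw [Nat.factorial_succ]
      push_cast at hk ⊢
      field_simp
      ring
    have hcp : (a : ℂ) * (a : ℂ) ^ (-(s + 1)) = (a : ℂ) ^ (-s) := by
      rw [neg_add, Complex.cpow_add _ _ hac, Complex.cpow_neg_one]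
      field_simp
    refine mul_left_cancel₀ hs0 ?_
    linear_combination -h2 + hsum + s * Complex.Gamma s * hcp

/-! ### The Bessel integral `∫ x^{s-1} e^{-ax-b/x} dx` and its series. -/

/-- The weight `e^{-ax-b/x}` of the generalized inverse Gaussian law. -/
def gigWeight (a b : ℝ) (x : ℝ) : ℂ := (Real.exp (-a * x - b * x⁻¹) : ℂ)

theorem gigWeight_inv (a b x : ℝ) : gigWeight a b x⁻¹ = gigWeight b a x := by
  rw [gigWeight, gigWeight, inv_inv]; congr 2; ring

theorem measurable_gigWeight (a b : ℝ) : Measurable (gigWeight a b) := by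
  unfold gigWeight; fun_prop

theorem measurable_ofReal_cpow (s : ℂ) : Measurable fun x : ℝ => (x : ℂ) ^ s := by
  fun_prop

theorem integrableOn_gigWeight_Ioi_one {a b : ℝ} (ha : 0 < a) (hb : 0 ≤ b) (s : ℂ) :
    IntegrableOn (fun x : ℝ => (x : ℂ) ^ (s - 1) * gigWeight a b x) (Set.Ioi 1) := by
  refine Integrable.mono (integrableOn_cpow_mul_exp_neg_mul_Ioi_one ha s)
    ((measurable_ofReal_cpow _).mul (measurable_gigWeight a b)).aestronglyMeasurable ?_
  filter_upwards [ae_restrict_mem measurableSet_Ioi] with x hx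
  have hx : (1 : ℝ) < x := hx
  rw [norm_mul, norm_mul, gigWeight, Complex.norm_real, Complex.norm_real,
    Real.norm_of_nonneg (Real.exp_nonneg _), Real.norm_of_nonneg (Real.exp_nonneg _)]
  gcongr
  have : 0 ≤ b * x⁻¹ := by positivity
  linarith

theorem mellinConvergent_gigWeight_comp_inv {a b : ℝ} {s : ℂ} :
    MellinConvergent (gigWeight a b) s ↔ MellinConvergent (gigWeight b a) (-s) := by
  have := MellinConvergent.comp_rpow (f := gigWeight a b) (s := -s) (a := -1) (by norm_num)
  rw [show -s / ((-1 : ℝ) : ℂ) = s by simp] at this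
  rw [← this]
  simp only [Real.rpow_neg_one, gigWeight_inv]

theorem mellin_gigWeight_neg (a b : ℝ) (s : ℂ) :
    mellin (gigWeight b a) (-s) = mellin (gigWeight a b) s := by
  rw [← mellin_comp_inv]
  simp only [gigWeight_inv]

theorem mellin_indicator_gigWeight {a b : ℝ} {s : ℂ} :
    mellin (Set.indicator (Set.Ioi 1) (gigWeight a b)) s =
      ∫ x in Set.Ioi (1 : ℝ), (x : ℂ) ^ (s - 1) * gigWeight a b x := by
  have h : ∀ x : ℝ, (x : ℂ) ^ (s - 1) • Set.indicator (Set.Ioi 1) (gigWeight a b) x =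
      Set.indicator (Set.Ioi 1) (fun x : ℝ => (x : ℂ) ^ (s - 1) * gigWeight a b x) x := fun x => by
    by_cases hx : x ∈ Set.Ioi (1 : ℝ) <;> simp [hx]
  rw [mellin]
  simp only [h]
  rw [setIntegral_indicator measurableSet_Ioi, Set.inter_eq_self_of_subset_right
    (Set.Ioi_subset_Ioi zero_le_one)]

theorem mellinConvergent_indicator_gigWeight {a b : ℝ} (ha : 0 < a) (hb : 0 ≤ b) (s : ℂ) :
    MellinConvergent (Set.indicator (Set.Ioi 1) (gigWeight a b)) s := by
  have h : ∀ x : ℝ, (x : ℂ) ^ (s - 1) • Set.indicator (Set.Ioi 1) (gigWeight a b) x =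
      Set.indicator (Set.Ioi 1) (fun x : ℝ => (x : ℂ) ^ (s - 1) * gigWeight a b x) x := fun x => by
    by_cases hx : x ∈ Set.Ioi (1 : ℝ) <;> simp [hx]
  rw [MellinConvergent]
  simp only [h]
  exact ((integrableOn_gigWeight_Ioi_one ha hb s).integrable_indicator
    measurableSet_Ioi).integrableOn

/-- The integral is cut at `x = 1`, and `x ↦ x⁻¹` maps the part over `(0, 1)` to `(1, ∞)`,
exchanging `a` with `b` and `s` with `-s`. -/
theorem hasMellin_gigWeight {a b : ℝ} (ha : 0 < a) (hb : 0 < b) (s : ℂ) :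
    HasMellin (gigWeight a b) s
      ((∫ x in Set.Ioi (1 : ℝ), (x : ℂ) ^ (s - 1) * gigWeight a b x) +
        ∫ x in Set.Ioi (1 : ℝ), (x : ℂ) ^ (-s - 1) * gigWeight b a x) := by
  have c1 := mellinConvergent_indicator_gigWeight ha hb.le s
  have c2 := mellinConvergent_indicator_gigWeight hb ha.le (-s)
  have c2' := (MellinConvergent.comp_rpow (f := Set.indicator (Set.Ioi 1) (gigWeight b a))
    (s := s) (a := -1) (by norm_num)).mpr (by
      rwa [show s / ((-1 : ℝ) : ℂ) = -s by simp [div_neg]])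
  simp only [Real.rpow_neg_one] at c2'
  have hadd := hasMellin_add c1 c2'
  rw [mellin_comp_inv, mellin_indicator_gigWeight, mellin_indicator_gigWeight] at hadd
  have hae : ∀ᵐ x : ℝ ∂volume.restrict (Set.Ioi (0 : ℝ)),
      (x : ℂ) ^ (s - 1) • (Set.indicator (Set.Ioi 1) (gigWeight a b) x +
        Set.indicator (Set.Ioi 1) (gigWeight b a) x⁻¹) = (x : ℂ) ^ (s - 1) • gigWeight a b x := by
    have h1 : ∀ᵐ x ∂volume.restrict (Set.Ioi (0 : ℝ)), x ≠ 1 :=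
      ae_restrict_of_ae (Measure.ae_ne volume 1)
    filter_upwards [ae_restrict_mem measurableSet_Ioi, h1] with x hx hx1
    have hx : (0 : ℝ) < x := hx
    congr 1
    rcases lt_or_gt_of_ne hx1 with h | h
    · have h' : x⁻¹ ∈ Set.Ioi (1 : ℝ) := (one_lt_inv₀ hx).mpr h
      have h'' : x ∉ Set.Ioi (1 : ℝ) := fun h3 => absurd h (not_lt.mpr (le_of_lt h3))
      rw [Set.indicator_of_mem h', Set.indicator_of_notMem h'', zero_add, gigWeight_inv]
    · have h' : x⁻¹ ∉ Set.Ioi (1 : ℝ) := fun h3 =>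
        absurd ((one_lt_inv₀ hx).mp h3) (not_lt.mpr h.le)
      rw [Set.indicator_of_notMem h', Set.indicator_of_mem (show x ∈ Set.Ioi (1 : ℝ) from h),
        add_zero]
  refine ⟨(integrable_congr hae).mp hadd.1, ?_⟩
  rw [← hadd.2]
  exact (integral_congr_ae hae).symm

theorem mellinConvergent_gigWeight_zero {a : ℝ} (ha : 0 < a) {s : ℂ} (hs : 0 < s.re) :
    MellinConvergent (gigWeight a 0) s := by
  have h := (integrableOn_cpow_mul_exp_neg_mul_Ioc a hs).union
    (integrableOn_cpow_mul_exp_neg_mul_Ioi_one ha s)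
  rw [Set.Ioc_union_Ioi_eq_Ioi zero_le_one] at h
  simpa [MellinConvergent, gigWeight] using h

theorem mellin_gigWeight_zero {a : ℝ} (ha : 0 < a) {s : ℂ} (hs : 0 < s.re) :
    mellin (gigWeight a 0) s = (a : ℂ) ^ (-s) * Complex.Gamma s := by
  have h1 := Complex.integral_cpow_mul_exp_neg_mul_Ioi hs ha
  rw [one_div, Complex.inv_cpow _ _ (by
    rw [Complex.arg_ofReal_of_nonneg ha.le]; exact Real.pi_pos.ne), ← Complex.cpow_neg] at h1
  rw [← h1, mellin]
  refine setIntegral_congr_fun measurableSet_Ioi fun x _ => ?_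
  simp [gigWeight]

/-- Expansion of `e^{-b/x}`; on `x > 1` the powers `x^{-l}` are at most `1`, so the series is
dominated by that of `e^b`. -/
theorem hasSum_integral_gigWeight_Ioi_one {a b : ℝ} (ha : 0 < a) (hb : 0 < b) (s : ℂ) :
    HasSum (fun l : ℕ => (-b : ℂ) ^ l / l.factorial * expTail a (s - l))
      (∫ x in Set.Ioi (1 : ℝ), (x : ℂ) ^ (s - 1) * gigWeight a b x) := by
  have hint : ∀ l : ℕ, IntegrableOn (fun x : ℝ => (-b : ℂ) ^ l / l.factorial *
      ((x : ℂ) ^ (s - l - 1) * (Real.exp (-a * x) : ℂ))) (Set.Ioi 1) := fun l =>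
    (integrableOn_cpow_mul_exp_neg_mul_Ioi_one ha (s - l)).const_mul _
  have hnorm : Summable fun l : ℕ => ∫ x in Set.Ioi (1 : ℝ), ‖(-b : ℂ) ^ l / l.factorial *
      ((x : ℂ) ^ (s - l - 1) * (Real.exp (-a * x) : ℂ))‖ := by
    refine Summable.of_nonneg_of_le (fun k => integral_nonneg fun x => norm_nonneg _) (fun l => ?_)
      ((Real.summable_pow_div_factorial b).mul_right
        (∫ x in Set.Ioi (1 : ℝ), ‖(x : ℂ) ^ (s - 1) * (Real.exp (-a * x) : ℂ)‖))
    rw [← integral_const_mul]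
    refine setIntegral_mono_on (hint l).norm
      ((integrableOn_cpow_mul_exp_neg_mul_Ioi_one ha s).norm.const_mul _)
      measurableSet_Ioi fun x hx => ?_
    have hx : (1 : ℝ) < x := hx
    rw [norm_mul, norm_div, norm_pow, norm_neg, Complex.norm_real, Complex.norm_natCast,
      Real.norm_of_nonneg hb.le, norm_mul, norm_mul,
      Complex.norm_cpow_eq_rpow_re_of_pos (by linarith),
      Complex.norm_cpow_eq_rpow_re_of_pos (by linarith)]
    gcongr ?_ * (?_ * ?_)
    exact Real.rpow_le_rpow_of_exponent_le hx.le (by simp)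
  have h := hasSum_integral_of_summable_integral_norm hint hnorm
  simp only [integral_const_mul] at h
  convert! h using 1
  refine setIntegral_congr_fun measurableSet_Ioi fun x hx => ?_
  have hx0 : (0 : ℝ) < x := zero_lt_one.trans hx
  have hxc : (x : ℂ) ≠ 0 := by exact_mod_cast hx0.ne'
  have he : gigWeight a b x = (Real.exp (-a * x) : ℂ) *
      ∑' k : ℕ, (-b * (x : ℂ)⁻¹ : ℂ) ^ k / k.factorial := by
    rw [gigWeight, sub_eq_add_neg, Real.exp_add, Complex.ofReal_mul]
    congr 1
    rw [Complex.ofReal_exp, Complex.exp_eq_exp_ℂ, NormedSpace.exp_eq_tsum_div]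
    push_cast
    simp only [neg_mul]
  rw [he, ← tsum_mul_left, ← tsum_mul_left]
  refine tsum_congr fun k => ?_
  rw [sub_right_comm, Complex.cpow_sub _ (k : ℂ) hxc, Complex.cpow_natCast, mul_pow, inv_pow]
  ring

/-- The double series that arises from expanding both exponentials. -/
def bilateralTerm (a b : ℝ) (s : ℂ) (p : ℕ × ℕ) : ℂ :=
  (-b : ℂ) ^ p.1 / p.1.factorial * ((-a : ℂ) ^ p.2 / p.2.factorial * (s - p.1 + p.2)⁻¹)

theorem summable_bilateralTerm {a b : ℝ} (ha : 0 < a) (hb : 0 < b) (s : ℂ) :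
    Summable (bilateralTerm a b s) := by
  obtain ⟨C, hC, hbd⟩ := exists_norm_inv_add_intCast_le s
  have h1 : Summable fun p : ℕ × ℕ => b ^ p.1 / p.1.factorial * (a ^ p.2 / p.2.factorial) :=
    (Real.summable_pow_div_factorial b).mul_of_nonneg
      (Real.summable_pow_div_factorial a) (fun n => by positivity) (fun n => by positivity)
  refine Summable.of_norm_bounded (h1.mul_right C) fun p => ?_
  rw [bilateralTerm, norm_mul, norm_mul, norm_div, norm_div, norm_pow, norm_pow, norm_neg, norm_neg,
    Complex.norm_real, Complex.norm_real, Complex.norm_natCast, Complex.norm_natCast,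
    Real.norm_of_nonneg ha.le, Real.norm_of_nonneg hb.le, ← mul_assoc]
  gcongr
  have := hbd (-(p.1 : ℤ) + p.2)
  rwa [Int.cast_add, Int.cast_neg, Int.cast_natCast, Int.cast_natCast, ← add_assoc,
    ← sub_eq_add_neg] at this

theorem hasSum_residues_gigWeight_Ioi_one {a b : ℝ} (ha : 0 < a) (hb : 0 < b) {s : ℂ}
    (hs : ∀ m : ℤ, s ≠ m) :
    HasSum (fun l : ℕ => (-b : ℂ) ^ l / l.factorial *
        ((a : ℂ) ^ (-(s - l)) * Complex.Gamma (s - l)))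
      ((∫ x in Set.Ioi (1 : ℝ), (x : ℂ) ^ (s - 1) * gigWeight a b x) +
        ∑' p : ℕ × ℕ, bilateralTerm a b s p) := by
  have h1 := hasSum_integral_gigWeight_Ioi_one ha hb s
  have hfib : ∀ l : ℕ, HasSum (fun k : ℕ => bilateralTerm a b s (l, k))
      ((-b : ℂ) ^ l / l.factorial *
        ∑' k : ℕ, (-a : ℂ) ^ k / k.factorial * (s - l + k)⁻¹) := fun l => by
    have h := (summable_pow_div_factorial_mul_inv a (s - l)).hasSum.mul_left
      ((-b : ℂ) ^ l / l.factorial)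
    simp only [bilateralTerm]
    exact h
  have h2 := (summable_bilateralTerm ha hb s).hasSum.prod_fiberwise hfib
  convert! h1.add h2 using 1
  funext l
  rw [expTail_eq ha]
  · ring
  · intro k hk
    refine hs ((l : ℤ) - k) ?_
    push_cast
    linear_combination hk

/-- Converts the values `Γ(s-l)` produced by the expansion into the quotients `Γ(s)Γ(1-s)/Γ(1+l-s)`
that occur in the kernels. -/
theorem neg_one_pow_mul_Gamma_sub_mul {s : ℂ} (hs : ∀ m : ℤ, s ≠ m) (l : ℕ) :
    (-1) ^ l * Complex.Gamma (s - l) * Complex.Gamma (1 + l - s) =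
      Complex.Gamma s * Complex.Gamma (1 - s) := by
  induction l with
  | zero => simp
  | succ l ih =>
    have h0 : s - (l + 1 : ℕ) ≠ 0 := fun h => hs (l + 1) (by push_cast at h ⊢; linear_combination h)
    have h1 : 1 + l - s ≠ 0 := fun h => h0 (by push_cast; linear_combination -h)
    have e1 := Complex.Gamma_add_one _ h0
    have e2 := Complex.Gamma_add_one _ h1
    rw [show s - (l + 1 : ℕ) + 1 = s - l by push_cast; ring] at e1
    rw [show 1 + (l : ℂ) - s + 1 = 1 + (l + 1 : ℕ) - s by push_cast; ring] at e2
    rw [← ih, e1, e2]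
    push_cast
    ring

theorem Gamma_ne_zero_of_ne_intCast {s : ℂ} (hs : ∀ m : ℤ, s ≠ m) : Complex.Gamma s ≠ 0 :=
  Complex.Gamma_ne_zero fun m h => hs (-m) (by simpa using h)

/-- The `l`-th term of the expansion of the Bessel integral `∫ x^{s-1} e^{-ax-b/x} dx` in powers
of `ab`, with prefactors `A = a^{-s}` and `B = b^s`. -/
def besselTerm (A B s : ℂ) (l : ℕ) : ℂ :=
  A * (Complex.Gamma s * Complex.Gamma (1 - s) / Complex.Gamma (1 + l - s)) -
    B * (Complex.Gamma s * Complex.Gamma (1 - s) / Complex.Gamma (1 + l + s))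

theorem hasSum_besselTerm {a b : ℝ} (ha : 0 < a) (hb : 0 < b) {s : ℂ} (hs : ∀ m : ℤ, s ≠ m) :
    HasSum (fun l : ℕ => besselTerm ((a : ℂ) ^ (-s)) ((b : ℂ) ^ s) s l *
      (((a * b) ^ l / l.factorial : ℝ) : ℂ)) (mellin (gigWeight a b) s) := by
  have hac : (a : ℂ) ≠ 0 := by exact_mod_cast ha.ne'
  have hbc : (b : ℂ) ≠ 0 := by exact_mod_cast hb.ne'
  have hns : ∀ m : ℤ, -s ≠ m := fun m h => hs (-m) (by push_cast; rw [← h, neg_neg])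
  have h1 := hasSum_residues_gigWeight_Ioi_one ha hb hs
  have h2 := hasSum_residues_gigWeight_Ioi_one hb ha hns
  -- Exchanging `a` with `b`, `s` with `-s` and the two indices negates the denominator `s - l + k`
  -- and nothing else, so the double series of the two halves cancel.
  have hcancel : ∑' p : ℕ × ℕ, bilateralTerm b a (-s) p =
      - ∑' p : ℕ × ℕ, bilateralTerm a b s p := by
    rw [← (Equiv.prodComm ℕ ℕ).tsum_eq, ← tsum_neg]
    refine tsum_congr fun p => ?_
    simp only [Equiv.prodComm_apply, Prod.fst_swap, Prod.snd_swap, bilateralTerm]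
    rw [show -s - (p.2 : ℂ) + p.1 = -(s - p.1 + p.2) by ring, inv_neg]
    ring
  rw [hcancel] at h2
  have h := h1.add h2
  rw [(hasMellin_gigWeight ha hb s).2]
  convert! h using 1
  · funext l
    have g1 := neg_one_pow_mul_Gamma_sub_mul hs l
    have g2 := neg_one_pow_mul_Gamma_sub_mul hns l
    have hs0 : s ≠ 0 := by simpa using hs 0
    have g3 := Complex.Gamma_add_one s hs0
    have g4 := Complex.Gamma_add_one (-s) (neg_ne_zero.mpr hs0)
    have n1 : Complex.Gamma (1 + l - s) ≠ 0 := Gamma_ne_zero_of_ne_intCast fun m h =>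
      hs (1 + l - m) (by push_cast; linear_combination -h)
    have n2 : Complex.Gamma (1 + l + s) ≠ 0 := Gamma_ne_zero_of_ne_intCast fun m h =>
      hs (m - 1 - l) (by push_cast; linear_combination h)
    have e1 : Complex.Gamma s * Complex.Gamma (1 - s) / Complex.Gamma (1 + l - s) =
        (-1) ^ l * Complex.Gamma (s - l) := by rw [div_eq_iff n1, g1]
    -- The minus sign comes from `Γ(-s)Γ(1+s) = -Γ(s)Γ(1-s)`.
    have e2 : Complex.Gamma s * Complex.Gamma (1 - s) / Complex.Gamma (1 + l + s) =
        -((-1) ^ l * Complex.Gamma (-s - l)) := by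
      rw [div_eq_iff n2]
      rw [sub_neg_eq_add, sub_neg_eq_add, add_comm 1 s, g3] at g2
      rw [show (1 : ℂ) - s = -s + 1 by ring, g4]
      linear_combination g2
    have c1 : (a : ℂ) ^ (-(s - l)) = (a : ℂ) ^ (-s) * (a : ℂ) ^ l := by
      rw [neg_sub, sub_eq_neg_add, Complex.cpow_add _ _ hac, Complex.cpow_natCast]
    have c2 : (b : ℂ) ^ (-(-s - l)) = (b : ℂ) ^ s * (b : ℂ) ^ l := by
      rw [neg_sub, sub_neg_eq_add, add_comm, Complex.cpow_add _ _ hbc, Complex.cpow_natCast]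
    rw [besselTerm, e1, e2, c1, c2]
    push_cast
    rw [mul_pow, neg_pow (b : ℂ), neg_pow (a : ℂ)]
    ring
  · ring

/-! ### Gamma quotients and kernels along an admissible line. -/

theorem norm_Gamma_div_Gamma_add_le {C : ℝ} {w : ℂ} (h0 : ∀ k : ℕ, w + k ≠ 0)
    (hC : ∀ k : ℕ, ‖(w + k)⁻¹‖ ≤ C) (l : ℕ) :
    ‖Complex.Gamma w / Complex.Gamma (w + l)‖ ≤ C ^ l := by
  have hG : Complex.Gamma w ≠ 0 := Complex.Gamma_ne_zero fun m h => h0 m (by rw [h]; ring)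
  induction l with
  | zero => simp [hG]
  | succ l ih =>
    have : Complex.Gamma (w + (l + 1 : ℕ)) = (w + l) * Complex.Gamma (w + l) := by
      rw [← Complex.Gamma_add_one _ (h0 l)]; push_cast; ring_nf
    rw [this, div_mul_eq_div_div_swap, div_eq_mul_inv _ (w + (l : ℂ)), norm_mul, pow_succ]
    have hC0 : 0 ≤ C := (norm_nonneg _).trans (hC 0)
    gcongr
    exact hC l

theorem Complex.ofReal_rpow_cpow {x : ℝ} (hx : 0 < x) (p : ℝ) (w : ℂ) :
    ((x ^ p : ℝ) : ℂ) ^ w = (x : ℂ) ^ (p * w) := by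
  rw [Complex.cpow_def_of_ne_zero (by exact_mod_cast (Real.rpow_pos_of_pos hx p).ne'),
    Complex.cpow_def_of_ne_zero (by exact_mod_cast hx.ne'), ← Complex.ofReal_log
    (Real.rpow_pos_of_pos hx p).le, ← Complex.ofReal_log hx.le, Real.log_rpow hx]
  push_cast; ring_nf

theorem Complex.ofReal_mul_cpow {y : ℝ} (hy : 0 < y) {z : ℂ} (hz : z ≠ 0) (w : ℂ) :
    ((y : ℂ) * z) ^ w = (y : ℂ) ^ w * z ^ w := by
  have hy' : (y : ℂ) ≠ 0 := by exact_mod_cast hy.ne'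
  rw [Complex.cpow_def_of_ne_zero (mul_ne_zero hy' hz), Complex.cpow_def_of_ne_zero hy',
    Complex.cpow_def_of_ne_zero hz, Complex.log_ofReal_mul hy hz, ← Complex.exp_add,
    ← Complex.ofReal_log hy.le]
  ring_nf

namespace IParams

/-- The Bessel order `α + r - σ s` at `s = c + i t`. -/
def order (α σ r c t : ℝ) : ℂ := α + r - σ * ((c : ℂ) + t * Complex.I)

theorem order_re (α σ r c t : ℝ) : (order α σ r c t).re = α + r - σ * c := by simp [order]

theorem continuous_order (α σ r c : ℝ) : Continuous (order α σ r c) := by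
  unfold order; fun_prop

theorem IsValid.isNonneg {P : IParams} (h : P.IsValid) : P.IsNonneg := fun t ht =>
  ⟨(h t ht).1.le, (h t ht).2.le⟩

theorem IsNonneg.momentFst {P : IParams} (h : P.IsNonneg) {α σ r : ℝ} (hσ : 0 ≤ σ) (l : ℕ) :
    (P.momentFst α σ r l).IsNonneg := by
  intro t ht
  simp only [IParams.momentFst, List.mem_append, List.mem_cons, List.not_mem_nil, or_false] at ht
  have key := h t
  simp only [List.mem_append] at key
  rcases ht with (((rfl | ht) | (ht | rfl)) | (rfl | ht)) | ht
  all_goals first | exact ⟨hσ, zero_le_one⟩ | exact key (by tauto)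

theorem IsNonneg.momentSnd {P : IParams} (h : P.IsNonneg) {α σ r : ℝ} (hσ : 0 ≤ σ) (l : ℕ) :
    (P.momentSnd α σ r l).IsNonneg := by
  intro t ht
  simp only [IParams.momentSnd, List.mem_append, List.mem_cons, List.not_mem_nil, or_false] at ht
  have key := h t
  simp only [List.mem_append] at key
  rcases ht with (((rfl | ht) | ht) | (rfl | ht)) | (ht | rfl)
  all_goals first | exact ⟨hσ, zero_le_one⟩ | exact key (by tauto)

theorem IsPath.of_momentFst {P : IParams} {α σ r c : ℝ} {l : ℕ}
    (h : (P.momentFst α σ r l).IsPath c) : P.IsPath c where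
  right t ht := h.right t (List.mem_cons_of_mem _ ht)
  left t ht := h.left t (List.mem_cons_of_mem _ ht)
  cut_upper t ht := h.cut_upper t (List.mem_append_left _ ht)
  cut_lower t ht := h.cut_lower t ht

/-- An integer `m ≤ 0` would be a pole of `Γ(ν)`, which must lie strictly to the right of the line,
and `m ≥ 1` a pole of `Γ(1-ν)`, which must lie strictly to the left. For `σ = 0` the same conditions
express that the constant factors are finite. -/
theorem IsPath.order_ne_intCast {P : IParams} {α σ r c : ℝ} {l : ℕ}
    (h : (P.momentFst α σ r l).IsPath c) (t : ℝ) (m : ℤ) : order α σ r c t ≠ m := by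
  intro hm
  unfold order at hm
  rcases le_or_gt m 0 with h0 | h0
  · obtain ⟨k, hk⟩ := Int.eq_ofNat_of_zero_le (neg_nonneg.mpr h0)
    have hk' : (m : ℂ) = -(k : ℂ) := by
      have : m = -(k : ℤ) := by simpa [neg_eq_iff_eq_neg] using hk
      rw [this]; push_cast; rfl
    have := h.right _ (List.mem_cons_self) (c + t * Complex.I) k (by
      simp only
      linear_combination hm + hk')
    simp at this
  · obtain ⟨k, hk⟩ := Int.eq_ofNat_of_zero_le (sub_nonneg.mpr (Int.add_one_le_iff.mpr h0))
    have hk' : (m : ℂ) = 1 + (k : ℂ) := by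
      have : m = 1 + (k : ℤ) := by
        have hk : m - (0 + 1) = (k : ℤ) := hk
        omega
      rw [this]; push_cast; rfl
    have := h.left _ (List.mem_cons_self) (c + t * Complex.I) k (by
      simp only
      linear_combination -hm - hk')
    simp at this

theorem IsPath.order_re_mem_Ioo {P : IParams} {α σ r c : ℝ} {l : ℕ}
    (h : (P.momentFst α σ r l).IsPath c) (hσ : 0 < σ) :
    α + r - σ * c ∈ Set.Ioo (0 : ℝ) 1 := by
  have h1 := h.re_upperNum_pos (List.mem_cons_self) hσ
  have h2 := h.re_lowerNum_pos (List.mem_cons_self) hσ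
  simp at h1 h2
  constructor <;> linarith

theorem momentFst_chi (P : IParams) (α σ r c t : ℝ) (l : ℕ) :
    (P.momentFst α σ r l).chi (c + t * Complex.I) = P.chi (c + t * Complex.I) *
      (Complex.Gamma (order α σ r c t) * Complex.Gamma (1 - order α σ r c t) /
        Complex.Gamma (1 + l - order α σ r c t)) := by
  rw [chi, chi]
  simp only [momentFst, List.map_cons, List.prod_cons, List.map_append, List.prod_append,
    List.map_nil, List.prod_nil, mul_one, gammaPow_one]
  rw [show (1 : ℂ) - (1 - α - r) - σ * ((c : ℂ) + t * Complex.I) = order α σ r c t by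
      rw [order]; ring,
    show (1 : ℂ) - α - r + σ * ((c : ℂ) + t * Complex.I) = 1 - order α σ r c t by
      rw [order]; ring,
    show (1 : ℂ) + l - α - r + σ * ((c : ℂ) + t * Complex.I) = 1 + l - order α σ r c t by
      rw [order]; ring, div_mul_div_comm]
  congr 1 <;> ring

theorem momentSnd_chi (P : IParams) (α σ r c t : ℝ) (l : ℕ) :
    (P.momentSnd α σ r l).chi (c + t * Complex.I) = P.chi (c + t * Complex.I) *
      (Complex.Gamma (order α σ r c t) * Complex.Gamma (1 - order α σ r c t) /
        Complex.Gamma (1 + l + order α σ r c t)) := by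
  rw [chi, chi]
  simp only [momentSnd, List.map_cons, List.prod_cons, List.map_append, List.prod_append,
    List.map_nil, List.prod_nil, mul_one, gammaPow_one]
  rw [show (1 : ℂ) - (1 - α - r) - σ * ((c : ℂ) + t * Complex.I) = order α σ r c t by
      rw [order]; ring,
    show (1 : ℂ) - α - r + σ * ((c : ℂ) + t * Complex.I) = 1 - order α σ r c t by
      rw [order]; ring,
    show (1 : ℂ) - (-l - α - r) - σ * ((c : ℂ) + t * Complex.I) = 1 + l + order α σ r c t by
      rw [order]; ring, div_mul_div_comm]
  congr 1 <;> ring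

theorem IsPath.exists_norm_Gamma_quotient_le {P : IParams} {α σ r c : ℝ}
    (h : (P.momentFst α σ r 0).IsPath c) (hσ : 0 ≤ σ) :
    ∃ M C : ℝ, 0 ≤ M ∧ 0 ≤ C ∧ ∀ (l : ℕ) (t : ℝ),
      ‖Complex.Gamma (order α σ r c t) * Complex.Gamma (1 - order α σ r c t) /
        Complex.Gamma (1 + l - order α σ r c t)‖ ≤ M * C ^ l ∧
      ‖Complex.Gamma (order α σ r c t) * Complex.Gamma (1 - order α σ r c t) /
        Complex.Gamma (1 + l + order α σ r c t)‖ ≤ M * C ^ l := by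
  obtain ⟨M, hM, hMb⟩ : ∃ M, 0 ≤ M ∧ ∀ t, ‖Complex.Gamma (order α σ r c t)‖ ≤ M ∧
      ‖Complex.Gamma (1 - order α σ r c t)‖ ≤ M := by
    rcases hσ.eq_or_lt with rfl | hσ
    · refine ⟨max ‖Complex.Gamma (α + r)‖ ‖Complex.Gamma (1 - (α + r))‖,
        le_max_of_le_left (norm_nonneg _), fun t => ?_⟩
      simp [order]
    · obtain ⟨p1, p2⟩ := h.order_re_mem_Ioo hσ
      refine ⟨max (Real.Gamma (α + r - σ * c)) (Real.Gamma (1 - (α + r - σ * c))),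
        le_max_of_le_left (Real.Gamma_pos_of_pos p1).le, fun t => ⟨?_, ?_⟩⟩
      · refine (Complex.norm_Gamma_le_Gamma_re (by rw [order_re]; exact p1)).trans ?_
        rw [order_re]; exact le_max_left _ _
      · have hre : (1 - order α σ r c t).re = 1 - (α + r - σ * c) := by
          rw [Complex.sub_re, order_re, Complex.one_re]
        refine (Complex.norm_Gamma_le_Gamma_re (by rw [hre]; linarith)).trans ?_
        rw [hre]; exact le_max_right _ _
  -- Along the line the distance of `ν` from any integer is smallest at the real point `t = 0`, so
  -- one constant serves all `t`.
  obtain ⟨C, hC, hCb⟩ := exists_norm_inv_add_intCast_le ((α + r - σ * c : ℝ) : ℂ)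
  have hCt : ∀ (t : ℝ) (m : ℤ), ‖(order α σ r c t + m)⁻¹‖ ≤ C := by
    intro t m
    refine le_trans ?_ (hCb m)
    have hne : ((α + r - σ * c : ℝ) : ℂ) + m ≠ 0 := by
      have := h.order_ne_intCast 0 (-m)
      intro h0
      apply this
      rw [order]
      push_cast at h0 ⊢
      linear_combination h0
    rw [norm_inv, norm_inv]
    refine inv_anti₀ (norm_pos_iff.mpr hne) ?_
    have h1 := Complex.abs_re_le_norm (order α σ r c t + m)
    rw [Complex.add_re, order_re, Complex.intCast_re] at h1
    refine le_trans (le_of_eq ?_) h1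
    rw [show ((α + r - σ * c : ℝ) : ℂ) + m = ((α + r - σ * c + m : ℝ) : ℂ) by push_cast; rfl,
      Complex.norm_real, Real.norm_eq_abs]
  -- `Γ(1+l-ν)` is `l` unit steps from `Γ(1-ν)`, but `Γ(1+l+ν)` is `l+1` steps from `Γ(ν)`; the
  -- extra step accounts for `M * C`.
  refine ⟨max M (M * C), C, le_max_of_le_left hM, hC, fun l t => ⟨?_, ?_⟩⟩
  · rw [mul_div_assoc, norm_mul, show (1 : ℂ) + l - order α σ r c t =
      (1 - order α σ r c t) + l by ring]
    have hb := norm_Gamma_div_Gamma_add_le (C := C) (w := 1 - order α σ r c t) (fun k h0 =>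
      h.order_ne_intCast t (1 + k) (by push_cast; linear_combination -h0)) (fun k => by
        have := hCt t (-(1 + k))
        rw [← norm_neg, ← inv_neg] at this
        convert! this using 3
        push_cast; ring) l
    calc _ ≤ M * C ^ l := by gcongr; exact (hMb t).1
      _ ≤ _ := by gcongr; exact le_max_left _ _
  · rw [mul_comm (Complex.Gamma (order α σ r c t)), mul_div_assoc, norm_mul,
      show (1 : ℂ) + l + order α σ r c t = order α σ r c t + (l + 1 : ℕ) by push_cast; ring]
    have hb := norm_Gamma_div_Gamma_add_le (C := C) (w := order α σ r c t) (fun k h0 =>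
      h.order_ne_intCast t (-k) (by push_cast; linear_combination h0)) (fun k => by
        simpa using hCt t k) (l + 1)
    calc _ ≤ M * C ^ (l + 1) := by gcongr; exact (hMb t).2
      _ = M * C * C ^ l := by ring
      _ ≤ _ := by gcongr; exact le_max_right _ _

theorem IsPath.continuous_Gamma_quotients {P : IParams} {α σ r c : ℝ}
    (h : (P.momentFst α σ r 0).IsPath c) (l : ℕ) :
    (Continuous fun t => Complex.Gamma (order α σ r c t) * Complex.Gamma (1 - order α σ r c t) /
        Complex.Gamma (1 + l - order α σ r c t)) ∧
    Continuous fun t => Complex.Gamma (order α σ r c t) * Complex.Gamma (1 - order α σ r c t) /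
        Complex.Gamma (1 + l + order α σ r c t) := by
  have ho := continuous_order α σ r c
  have key : ∀ g : ℝ → ℂ, Continuous g → (∀ t, ∀ m : ℤ, g t ≠ m) →
      (Continuous fun t => Complex.Gamma (g t)) ∧ ∀ t, Complex.Gamma (g t) ≠ 0 := by
    refine fun g hg hm => ⟨continuous_iff_continuousAt.mpr fun t => ?_, fun t =>
      Gamma_ne_zero_of_ne_intCast (hm t)⟩
    refine ContinuousAt.comp (g := Complex.Gamma) (f := g) ?_ hg.continuousAt
    exact (Complex.differentiableAt_Gamma _ fun m h => hm t (-m) (by simpa using h)).continuousAt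
  have k1 := key _ ho h.order_ne_intCast
  have k2 := key (fun t => 1 - order α σ r c t) (by fun_prop) fun t m h0 =>
    h.order_ne_intCast t (1 - m) (by push_cast; linear_combination -h0)
  have k3 := key (fun t => 1 + l - order α σ r c t) (by fun_prop) fun t m h0 =>
    h.order_ne_intCast t (1 + l - m) (by push_cast; linear_combination -h0)
  have k4 := key (fun t => 1 + l + order α σ r c t) (by fun_prop) fun t m h0 =>
    h.order_ne_intCast t (m - 1 - l) (by push_cast; linear_combination h0)
  exact ⟨(k1.1.mul k2.1).div k3.1 k3.2, (k1.1.mul k2.1).div k4.1 k4.2⟩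

theorem integrand_ofReal_mul (P : IParams) (c : ℝ) {y : ℝ} (hy : 0 < y) {δ : ℂ} (hδ : δ ≠ 0)
    (t : ℝ) : P.integrand c ((y : ℂ) * δ) t =
      (y : ℂ) ^ (-((c : ℂ) + t * Complex.I)) * P.integrand c δ t := by
  rw [integrand, integrand, Complex.ofReal_mul_cpow hy hδ]; ring

theorem continuous_cpow_line (c : ℝ) {y : ℝ} (hy : 0 < y) :
    Continuous fun t : ℝ => (y : ℂ) ^ (-((c : ℂ) + t * Complex.I)) :=
  Continuous.const_cpow (by fun_prop) (Or.inl (by exact_mod_cast hy.ne'))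

theorem norm_cpow_line (c : ℝ) {y : ℝ} (hy : 0 < y) (t : ℝ) :
    ‖(y : ℂ) ^ (-((c : ℂ) + t * Complex.I))‖ = y ^ (-c) := by
  rw [Complex.norm_cpow_eq_rpow_re_of_pos hy]; simp

/-- A positive factor changes the modulus of the integrand by the constant `y^{-c}`. Convergence at
`δ` alone therefore covers `δ x^σ`, `δ/a^σ` and `b^σ δ`. -/
theorem AbsConv.ofReal_mul {P : IParams} {c : ℝ} {δ : ℂ} (h : P.AbsConv c δ) {y : ℝ} (hy : 0 < y)
    (hδ : δ ≠ 0) : P.AbsConv c ((y : ℂ) * δ) := by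
  unfold AbsConv
  simp only [funext fun t => integrand_ofReal_mul P c hy hδ t]
  exact Integrable.bdd_mul h (continuous_cpow_line c hy).aestronglyMeasurable
    (Eventually.of_forall fun t => (norm_cpow_line c hy t).le)

theorem momentFst_integrand (P : IParams) (α σ r c t : ℝ) (l : ℕ) (z : ℂ) :
    (P.momentFst α σ r l).integrand c z t = (Complex.Gamma (order α σ r c t) *
      Complex.Gamma (1 - order α σ r c t) / Complex.Gamma (1 + l - order α σ r c t)) *
        P.integrand c z t := by
  rw [integrand, integrand, momentFst_chi]; ring

theorem momentSnd_integrand (P : IParams) (α σ r c t : ℝ) (l : ℕ) (z : ℂ) :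
    (P.momentSnd α σ r l).integrand c z t = (Complex.Gamma (order α σ r c t) *
      Complex.Gamma (1 - order α σ r c t) / Complex.Gamma (1 + l + order α σ r c t)) *
        P.integrand c z t := by
  rw [integrand, integrand, momentSnd_chi]; ring

theorem AbsConv.momentFst {P : IParams} {α σ r c : ℝ} {z : ℂ} (h : P.AbsConv c z)
    (hp : (P.momentFst α σ r 0).IsPath c) (hσ : 0 ≤ σ) (l : ℕ) :
    (P.momentFst α σ r l).AbsConv c z := by
  obtain ⟨M, C, -, -, hb⟩ := hp.exists_norm_Gamma_quotient_le hσ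
  unfold AbsConv
  simp only [funext fun t => momentFst_integrand P α σ r c t l z]
  exact Integrable.bdd_mul h (hp.continuous_Gamma_quotients l).1.aestronglyMeasurable
    (Eventually.of_forall fun t => (hb l t).1)

theorem AbsConv.momentSnd {P : IParams} {α σ r c : ℝ} {z : ℂ} (h : P.AbsConv c z)
    (hp : (P.momentFst α σ r 0).IsPath c) (hσ : 0 ≤ σ) (l : ℕ) :
    (P.momentSnd α σ r l).AbsConv c z := by
  obtain ⟨M, C, -, -, hb⟩ := hp.exists_norm_Gamma_quotient_le hσ
  unfold AbsConv
  simp only [funext fun t => momentSnd_integrand P α σ r c t l z]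
  exact Integrable.bdd_mul h (hp.continuous_Gamma_quotients l).2.aestronglyMeasurable
    (Eventually.of_forall fun t => (hb l t).2)

end IParams

/-! ### Exchange of the Bessel series with the Mellin-Barnes integral. -/

namespace IParams

/-- The factor `y^{-s}` on the line `s = c + i t`, scaled by a constant. -/
def linePower (k y c t : ℝ) : ℂ := (k : ℂ) * (y : ℂ) ^ (-((c : ℂ) + t * Complex.I))

theorem linePower_zero (y c t : ℝ) : linePower 0 y c t = 0 := by simp [linePower]

/-- The alternative `k = 0` serves `b = 0`, where `b^σ` may vanish but the prefactor `b^{α+r}` does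
too. -/
theorem exists_linePower_bound {k y : ℝ} (c : ℝ) (h : k = 0 ∨ 0 < y) :
    Continuous (linePower k y c) ∧ ∃ N, 0 ≤ N ∧ ∀ t, ‖linePower k y c t‖ ≤ N := by
  rcases h with rfl | hy
  · simp only [funext fun t => linePower_zero y c t]
    exact ⟨continuous_const, 0, le_rfl, fun t => by simp⟩
  · refine ⟨continuous_const.mul (continuous_cpow_line c hy), |k| * y ^ (-c), by positivity,
      fun t => ?_⟩
    rw [linePower, norm_mul, norm_cpow_line c hy, Complex.norm_real, Real.norm_eq_abs]

theorem const_mul_iFunction_momentFst {P : IParams} (hP : P.IsNonneg) {α σ r c : ℝ} {δ : ℂ}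
    (hσ : 0 ≤ σ) (hδ : δ ≠ 0) (hp : ∀ l, (P.momentFst α σ r l).IsPath c) (h : P.AbsConv c δ)
    (k : ℝ) {y : ℝ} (hy : 0 < y) (l : ℕ) :
    (k : ℂ) * (P.momentFst α σ r l).iFunction ((y : ℂ) * δ) =
      (2 * Real.pi * Complex.I)⁻¹ * ∫ t : ℝ, linePower k y c t *
        (Complex.Gamma (order α σ r c t) * Complex.Gamma (1 - order α σ r c t) /
          Complex.Gamma (1 + l - order α σ r c t)) * P.integrand c δ t * Complex.I := by
  rw [iFunction_eq_barnesIntegral (hP.momentFst hσ l) (hp l)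
    (mul_ne_zero (by exact_mod_cast hy.ne') hδ) ((h.ofReal_mul hy hδ).momentFst (hp 0) hσ l),
    barnesIntegral, mul_left_comm, ← integral_const_mul]
  congr 2
  funext t
  rw [momentFst_integrand, integrand_ofReal_mul P c hy hδ, linePower]
  ring

theorem const_mul_iFunction_momentSnd {P : IParams} (hP : P.IsNonneg) {α σ r c : ℝ} {δ : ℂ}
    (hσ : 0 ≤ σ) (hδ : δ ≠ 0) (hp : (P.momentFst α σ r 0).IsPath c)
    (hq : ∀ l, (P.momentSnd α σ r l).IsPath c) (h : P.AbsConv c δ)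
    {k y : ℝ} (hy : k = 0 ∨ 0 < y) (l : ℕ) :
    (k : ℂ) * (P.momentSnd α σ r l).iFunction ((y : ℂ) * δ) =
      (2 * Real.pi * Complex.I)⁻¹ * ∫ t : ℝ, linePower k y c t *
        (Complex.Gamma (order α σ r c t) * Complex.Gamma (1 - order α σ r c t) /
          Complex.Gamma (1 + l + order α σ r c t)) * P.integrand c δ t * Complex.I := by
  rcases hy with rfl | hy
  · simp [linePower_zero]
  rw [iFunction_eq_barnesIntegral (hP.momentSnd hσ l) (hq l)
    (mul_ne_zero (by exact_mod_cast hy.ne') hδ) ((h.ofReal_mul hy hδ).momentSnd hp hσ l),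
    barnesIntegral, mul_left_comm, ← integral_const_mul]
  congr 2
  funext t
  rw [momentSnd_integrand, integrand_ofReal_mul P c hy hδ, linePower]
  ring

theorem hasSum_ifigMomentTerm {P : IParams} (hP : P.IsNonneg) {α a b σ r c : ℝ} {δ : ℂ}
    (ha : 0 ≤ a) (hb : 0 ≤ b) (hσ : 0 ≤ σ) (hδ : δ ≠ 0)
    (hp : ∀ l, (P.momentFst α σ r l).IsPath c) (hq : ∀ l, (P.momentSnd α σ r l).IsPath c)
    (h : P.AbsConv c δ) (haσ : 0 < a ^ σ) (hbσ : b ^ (α + r) = 0 ∨ 0 < b ^ σ) {V : ℝ → ℂ}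
    (hV : ∀ t, HasSum (fun l : ℕ => besselTerm (linePower (a ^ (-α - r)) (a ^ σ)⁻¹ c t)
      (linePower (b ^ (α + r)) (b ^ σ) c t) (order α σ r c t) l *
        (((a * b) ^ l / l.factorial : ℝ) : ℂ)) (V t)) :
    HasSum (fun l => ifigMomentTerm P α a b σ δ r l)
      ((2 * Real.pi * Complex.I)⁻¹ * ∫ t : ℝ, V t * P.integrand c δ t * Complex.I) := by
  obtain ⟨hAc, A0, hA0, hA⟩ := exists_linePower_bound (k := a ^ (-α - r)) c
    (Or.inr (inv_pos.mpr haσ))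
  obtain ⟨hBc, B0, hB0, hB⟩ := exists_linePower_bound c hbσ
  obtain ⟨M, C, hM, hC, hb1⟩ := (hp 0).exists_norm_Gamma_quotient_le hσ
  set A := linePower (a ^ (-α - r)) (a ^ σ)⁻¹ c with hAdef
  set B := linePower (b ^ (α + r)) (b ^ σ) c with hBdef
  set Q : ℕ → ℝ → ℂ := fun l t => Complex.Gamma (order α σ r c t) *
    Complex.Gamma (1 - order α σ r c t) / Complex.Gamma (1 + l - order α σ r c t) with hQ
  set R : ℕ → ℝ → ℂ := fun l t => Complex.Gamma (order α σ r c t) *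
    Complex.Gamma (1 - order α σ r c t) / Complex.Gamma (1 + l + order α σ r c t) with hR
  set f := P.integrand c δ with hf
  have hfi : Integrable f := h
  have iA : ∀ l, Integrable fun t => A t * Q l t * f t * Complex.I := fun l =>
    (hfi.bdd_mul (c := A0 * (M * C ^ l))
      (hAc.mul ((hp 0).continuous_Gamma_quotients l).1).aestronglyMeasurable
      (Eventually.of_forall fun t => by
        rw [Pi.mul_apply, norm_mul]
        exact mul_le_mul (hA t) (hb1 l t).1 (norm_nonneg _) hA0)).mul_const _
  have iB : ∀ l, Integrable fun t => B t * R l t * f t * Complex.I := fun l =>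
    (hfi.bdd_mul (c := B0 * (M * C ^ l))
      (hBc.mul ((hp 0).continuous_Gamma_quotients l).2).aestronglyMeasurable
      (Eventually.of_forall fun t => by
        rw [Pi.mul_apply, norm_mul]
        exact mul_le_mul (hB t) (hb1 l t).2 (norm_nonneg _) hB0)).mul_const _
  set G : ℕ → ℝ → ℂ := fun l t => besselTerm (A t) (B t) (order α σ r c t) l *
    (((a * b) ^ l / l.factorial : ℝ) : ℂ) * f t * Complex.I with hG
  have hGeq : ∀ l, G l = fun t => (A t * Q l t * f t * Complex.I - B t * R l t * f t * Complex.I) *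
      (((a * b) ^ l / l.factorial : ℝ) : ℂ) := fun l => by
    funext t
    simp only [hG, hQ, hR, besselTerm]
    ring
  have hGint : ∀ l, ∫ t, G l t = ((∫ t, A t * Q l t * f t * Complex.I) -
      ∫ t, B t * R l t * f t * Complex.I) * (((a * b) ^ l / l.factorial : ℝ) : ℂ) := fun l => by
    rw [← integral_sub (iA l) (iB l), hGeq]
    exact integral_mul_const _ _
  have hGi : ∀ l, Integrable (G l) := fun l => by
    rw [hGeq]; exact ((iA l).sub (iB l)).mul_const _
  -- The geometric growth of the Gamma quotients is absorbed by `1/l!`, leaving an exponential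
  -- series times the integrable function `‖f‖`.
  have hGb : ∀ l t, ‖G l t‖ ≤ (C * (a * b)) ^ l / l.factorial * ((A0 + B0) * M * ‖f t‖) := by
    intro l t
    have hk : (0 : ℝ) ≤ (a * b) ^ l / l.factorial := by positivity
    rw [hGeq, norm_mul, ← sub_mul, ← sub_mul, norm_mul, norm_mul, Complex.norm_I, mul_one,
      Complex.norm_real, Real.norm_of_nonneg hk]
    have h1 : ‖A t * Q l t - B t * R l t‖ ≤ A0 * (M * C ^ l) + B0 * (M * C ^ l) := by
      refine (norm_sub_le _ _).trans (add_le_add ?_ ?_)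
      · rw [norm_mul]; exact mul_le_mul (hA t) (hb1 l t).1 (norm_nonneg _) hA0
      · rw [norm_mul]; exact mul_le_mul (hB t) (hb1 l t).2 (norm_nonneg _) hB0
    calc _ ≤ (A0 * (M * C ^ l) + B0 * (M * C ^ l)) * ‖f t‖ * ((a * b) ^ l / l.factorial) := by
          gcongr
      _ = _ := by rw [mul_pow]; ring
  have hnorm : Summable fun l => ∫ t, ‖G l t‖ := by
    refine Summable.of_nonneg_of_le (fun l => integral_nonneg fun t => norm_nonneg _) (fun l => ?_)
      ((Real.summable_pow_div_factorial (C * (a * b))).mul_right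
        (∫ t, (A0 + B0) * M * ‖f t‖))
    rw [← integral_const_mul]
    exact integral_mono (hGi l).norm ((hfi.norm.const_mul _).const_mul _) (hGb l)
  have hsum := (hasSum_integral_of_summable_integral_norm hGi hnorm).mul_left
    (2 * Real.pi * Complex.I)⁻¹
  have hVt : (fun t => ∑' l, G l t) = fun t => V t * f t * Complex.I := by
    funext t
    exact (((hV t).mul_right (f t)).mul_right Complex.I).tsum_eq
  rw [hVt] at hsum
  convert! hsum using 1
  funext l
  rw [ifigMomentTerm, show δ / ((a ^ σ : ℝ) : ℂ) = (((a ^ σ)⁻¹ : ℝ) : ℂ) * δ by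
      rw [Complex.ofReal_inv, div_eq_inv_mul],
    const_mul_iFunction_momentFst hP hσ hδ hp h _ (inv_pos.mpr haσ) l,
    const_mul_iFunction_momentSnd hP hσ hδ (hp 0) hq h hbσ l, hGint]
  ring

theorem linePower_rpow {x : ℝ} (hx : 0 < x) (α σ r c t : ℝ) :
    linePower (x ^ (α + r)) (x ^ σ) c t = (x : ℂ) ^ order α σ r c t := by
  have hx' : (x : ℂ) ≠ 0 := by exact_mod_cast hx.ne'
  rw [linePower, Complex.ofReal_rpow_cpow hx, Complex.ofReal_cpow hx.le, ← Complex.cpow_add _ _ hx',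
    order]
  congr 1
  push_cast
  ring

theorem linePower_rpow_inv {x : ℝ} (hx : 0 < x) (α σ r c t : ℝ) :
    linePower (x ^ (-α - r)) (x ^ σ)⁻¹ c t = (x : ℂ) ^ (-order α σ r c t) := by
  have hx' : (x : ℂ) ≠ 0 := by exact_mod_cast hx.ne'
  rw [linePower, ← Real.rpow_neg hx.le, Complex.ofReal_rpow_cpow hx, Complex.ofReal_cpow hx.le,
    ← Complex.cpow_add _ _ hx', order]
  congr 1
  push_cast
  ring

end IParams

/-- The Bessel integral converges and equals its series, in all cases of the parameters. -/
theorem hasSum_besselTerm_linePower {P : IParams} {α a b σ r c : ℝ} (ha : 0 ≤ a) (hb : 0 ≤ b)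
    (hσ : 0 ≤ σ) (hab : a ≠ 0 ∨ b ≠ 0) (haσ : a = 0 → σ = 0 ∧ α + r < 0)
    (hbα : b = 0 → 0 < α + r) (hp : (P.momentFst α σ r 0).IsPath c) (t : ℝ) :
    MellinConvergent (gigWeight a b) (IParams.order α σ r c t) ∧
    HasSum (fun l : ℕ => besselTerm (IParams.linePower (a ^ (-α - r)) (a ^ σ)⁻¹ c t)
      (IParams.linePower (b ^ (α + r)) (b ^ σ) c t) (IParams.order α σ r c t) l *
        (((a * b) ^ l / l.factorial : ℝ) : ℂ))
      (mellin (gigWeight a b) (IParams.order α σ r c t)) := by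
  have hν := hp.order_ne_intCast t
  set ν := IParams.order α σ r c t with hνdef
  have hνre : ν.re = α + r - σ * c := IParams.order_re α σ r c t
  have hsingle : a * b = 0 → ∀ A B : ℂ, HasSum (fun l : ℕ => besselTerm A B ν l *
      -- If `a` or `b` vanishes, the integral reduces to a complete Gamma integral and only `l = 0`
      -- contributes.
      (((a * b) ^ l / l.factorial : ℝ) : ℂ)) (besselTerm A B ν 0) := fun h0 A B => by
    convert! hasSum_single (f := fun l : ℕ => besselTerm A B ν l *
      (((a * b) ^ l / l.factorial : ℝ) : ℂ)) 0 (fun l hl => by simp [h0, hl]) using 1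
    simp
  have hG1 : Complex.Gamma (1 - ν) ≠ 0 := Gamma_ne_zero_of_ne_intCast fun m h =>
    hν (1 - m) (by push_cast; linear_combination -h)
  rcases ha.eq_or_lt with ha0 | ha0
  · obtain ⟨hσ0, hαr⟩ := haσ ha0.symm
    have hb0 : 0 < b := lt_of_le_of_ne hb fun h => by
      rcases hab with h1 | h1
      · exact h1 ha0.symm
      · exact h1 h.symm
    have hre : 0 < (-ν).re := by rw [Complex.neg_re, hνre, hσ0]; linarith
    subst ha0
    refine ⟨mellinConvergent_gigWeight_comp_inv.mpr (mellinConvergent_gigWeight_zero hb0 hre), ?_⟩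
    -- For `a = 0` inversion reduces to weight `e^{-bx}` at `-ν`. The first summand drops out
    -- because `0 ^ (-α - r) = 0`, the exponent being nonzero.
    rw [← mellin_gigWeight_neg, mellin_gigWeight_zero hb0 hre, neg_neg,
      Real.zero_rpow (by linarith : -α - r ≠ 0), IParams.linePower_zero,
      IParams.linePower_rpow hb0, ← hνdef]
    have hν0 : ν ≠ 0 := by simpa using hν 0
    have hG : Complex.Gamma ν ≠ 0 := Gamma_ne_zero_of_ne_intCast hν
    have hG' : Complex.Gamma (-ν) ≠ 0 := Gamma_ne_zero_of_ne_intCast fun m h =>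
      hν (-m) (by push_cast; rw [← h, neg_neg])
    have e1 := Complex.Gamma_add_one ν hν0
    have e2 := Complex.Gamma_add_one (-ν) (neg_ne_zero.mpr hν0)
    convert! hsingle (zero_mul b) _ _ using 1
    rw [besselTerm, Nat.cast_zero, add_zero, add_comm 1 ν, e1,
      show (1 : ℂ) - ν = -ν + 1 by ring, e2]
    field_simp
    ring
  · rcases hb.eq_or_lt with hb0 | hb0
    · have hαr := hbα hb0.symm
      have hre : 0 < ν.re := by
        rw [hνre]
        rcases hσ.eq_or_lt with h0 | h0
        · rw [← h0]; linarith
        · exact (hp.order_re_mem_Ioo h0).1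
      subst hb0
      refine ⟨mellinConvergent_gigWeight_zero ha0 hre, ?_⟩
      rw [mellin_gigWeight_zero ha0 hre, Real.zero_rpow hαr.ne', IParams.linePower_zero,
        IParams.linePower_rpow_inv ha0, ← hνdef]
      convert! hsingle (mul_zero a) _ _ using 1
      rw [besselTerm, Nat.cast_zero, add_zero]
      field_simp
      ring
    · refine ⟨(hasMellin_gigWeight ha0 hb0 ν).1, ?_⟩
      rw [IParams.linePower_rpow hb0, IParams.linePower_rpow_inv ha0]
      exact hasSum_besselTerm ha0 hb0 hν

/-! ### Fubini and passage to the random variable. -/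

/-- Fubini's theorem for the moment integral. -/
theorem integral_moment_kernel {P : IParams} {α a b σ r c : ℝ} {δ : ℂ} (h : P.AbsConv c δ)
    (hm : MellinConvergent (gigWeight a b) (IParams.order α σ r c 0)) :
    IntegrableOn (fun x : ℝ => ∫ t : ℝ, (x : ℂ) ^ (IParams.order α σ r c t - 1) *
      gigWeight a b x * P.integrand c δ t) (Set.Ioi 0) ∧
    ∫ x in Set.Ioi (0 : ℝ), ∫ t : ℝ, (x : ℂ) ^ (IParams.order α σ r c t - 1) *
      gigWeight a b x * P.integrand c δ t =
      ∫ t : ℝ, mellin (gigWeight a b) (IParams.order α σ r c t) * P.integrand c δ t := by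
  have hi : Integrable (fun p : ℝ × ℝ => (p.1 : ℂ) ^ (IParams.order α σ r c p.2 - 1) *
      gigWeight a b p.1 * P.integrand c δ p.2)
      ((volume.restrict (Set.Ioi 0)).prod volume) := by
    -- `x^{ν(t)-1}` is `x^{ν(0)-1}` times the phase `e^{-iσt log x}`, so up to a unimodular factor
    -- the integrand is a product of a function of `x` and a function of `t`.
    have h0 : Integrable (fun p : ℝ × ℝ => Complex.exp (((-σ * p.2 * Real.log p.1 : ℝ) : ℂ) *
        Complex.I) * (((p.1 : ℂ) ^ (IParams.order α σ r c 0 - 1) •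
        gigWeight a b p.1) * P.integrand c δ p.2))
        ((volume.restrict (Set.Ioi 0)).prod volume) := by
      have hm' : Integrable (fun x : ℝ => (x : ℂ) ^ (IParams.order α σ r c 0 - 1) •
        gigWeight a b x) (volume.restrict (Set.Ioi 0)) := hm
      refine (hm'.mul_prod h).bdd_mul (c := 1) ?_ (Eventually.of_forall fun p => ?_)
      · refine Measurable.aestronglyMeasurable ?_
        fun_prop
      · rw [Complex.norm_exp_ofReal_mul_I]
    refine h0.congr ?_
    have hpos : ∀ᵐ p ∂((volume.restrict (Set.Ioi (0 : ℝ))).prod (volume : Measure ℝ)),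
        (0 : ℝ) < p.1 :=
      Measure.quasiMeasurePreserving_fst.ae (ae_restrict_mem measurableSet_Ioi)
    filter_upwards [hpos] with p hp
    have hp' : (p.1 : ℂ) ≠ 0 := by exact_mod_cast hp.ne'
    rw [smul_eq_mul, ← mul_assoc, ← mul_assoc]
    congr 2
    rw [Complex.cpow_def_of_ne_zero hp', Complex.cpow_def_of_ne_zero hp', ← Complex.exp_add,
      ← Complex.ofReal_log hp.le, IParams.order, IParams.order]
    congr 1
    push_cast
    ring
  refine ⟨hi.integral_prod_left, ?_⟩
  rw [integral_integral_swap hi]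
  refine integral_congr_ae (Eventually.of_forall fun t => ?_)
  simp only [mellin, smul_eq_mul]
  rw [integral_mul_const]

/-- Path independence moves the Barnes integral in the density, for every `x`, to the one line `Re s
= c` on which the moment is computed. -/
theorem rpow_mul_ifigDensity {P : IParams} (hP : P.IsNonneg) {α a b σ r c : ℝ} {δ k₂ : ℂ}
    (hδ : δ ≠ 0) (hp : P.IsPath c) (h : P.AbsConv c δ) {x : ℝ} (hx : 0 < x) :
    ((x ^ r : ℝ) : ℂ) * ifigDensity P α a b σ δ k₂ x =
      k₂ * (2 * Real.pi * Complex.I)⁻¹ * Complex.I *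
      ∫ t : ℝ, (x : ℂ) ^ (IParams.order α σ r c t - 1) * gigWeight a b x *
        P.integrand c δ t := by
  have hxσ : 0 < x ^ σ := Real.rpow_pos_of_pos hx σ
  have hx' : (x : ℂ) ≠ 0 := by exact_mod_cast hx.ne'
  rw [ifigDensity, if_pos hx, mul_comm δ, IParams.iFunction_eq_barnesIntegral hP hp
    (mul_ne_zero (by exact_mod_cast hxσ.ne') hδ) (h.ofReal_mul hxσ hδ), IParams.barnesIntegral,
    integral_mul_const]
  have hint : ∀ t, (x : ℂ) ^ (IParams.order α σ r c t - 1) * gigWeight a b x *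
      P.integrand c δ t = (((x ^ (α + r) : ℝ) : ℂ) * (x : ℂ)⁻¹ * gigWeight a b x) *
        P.integrand c (((x ^ σ : ℝ) : ℂ) * δ) t := fun t => by
    rw [IParams.integrand_ofReal_mul P c hxσ hδ, Complex.cpow_sub _ _ hx', Complex.cpow_one,
      ← IParams.linePower_rpow hx, IParams.linePower]
    ring
  simp only [hint]
  rw [integral_const_mul]
  have e : ((x ^ r : ℝ) : ℂ) * ((x ^ (α - 1) * Real.exp (-a * x - b * x⁻¹) : ℝ) : ℂ) =
      ((x ^ (α + r) : ℝ) : ℂ) * (x : ℂ)⁻¹ * gigWeight a b x := by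
    rw [gigWeight, Real.rpow_add hx, Real.rpow_sub_one hx.ne']
    push_cast
    ring
  rw [← e]
  ring

theorem moment_ifigDensity {P : IParams} (hP : P.IsNonneg) {α a b σ r c : ℝ} {δ k₂ : ℂ}
    (hδ : δ ≠ 0) (hp : P.IsPath c) (h : P.AbsConv c δ)
    (hm : MellinConvergent (gigWeight a b) (IParams.order α σ r c 0)) :
    Integrable (fun x : ℝ => ((x ^ r : ℝ) : ℂ) * ifigDensity P α a b σ δ k₂ x) ∧
    ∫ x : ℝ, ((x ^ r : ℝ) : ℂ) * ifigDensity P α a b σ δ k₂ x = k₂ *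
      ((2 * Real.pi * Complex.I)⁻¹ * ∫ t : ℝ, mellin (gigWeight a b) (IParams.order α σ r c t) *
        P.integrand c δ t * Complex.I) := by
  obtain ⟨h1, h2⟩ := integral_moment_kernel h hm
  have hind : (fun x : ℝ => ((x ^ r : ℝ) : ℂ) * ifigDensity P α a b σ δ k₂ x) =
      Set.indicator (Set.Ioi 0) fun x : ℝ => k₂ * (2 * Real.pi * Complex.I)⁻¹ * Complex.I *
      ∫ t : ℝ, (x : ℂ) ^ (IParams.order α σ r c t - 1) * gigWeight a b x *
        P.integrand c δ t := by
    funext x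
    by_cases hx : 0 < x
    · rw [Set.indicator_of_mem (show x ∈ Set.Ioi (0 : ℝ) from hx),
        rpow_mul_ifigDensity hP hδ hp h hx]
    · rw [Set.indicator_of_notMem (show x ∉ Set.Ioi (0 : ℝ) from hx), ifigDensity, if_neg hx,
        mul_zero]
  rw [hind]
  refine ⟨IntegrableOn.integrable_indicator (Integrable.const_mul h1 _) measurableSet_Ioi, ?_⟩
  rw [integral_indicator measurableSet_Ioi, integral_const_mul, h2, integral_mul_const]
  ring

theorem IsIFIG.integrable_rpow_and_integral {Ω : Type*} [MeasurableSpace Ω] {μ : Measure Ω}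
    {X : Ω → ℝ} {P : IParams} {α a b σ : ℝ} {δ k₂ : ℂ} (hX : IsIFIG μ X P α a b σ δ k₂) {r : ℝ}
    (hi : Integrable (fun x : ℝ => ((x ^ r : ℝ) : ℂ) * ifigDensity P α a b σ δ k₂ x)) :
    Integrable (fun ω => X ω ^ r) μ ∧ ((∫ ω, X ω ^ r ∂μ : ℝ) : ℂ) =
      ∫ x : ℝ, ((x ^ r : ℝ) : ℂ) * ifigDensity P α a b σ δ k₂ x := by
  set f : ℝ → ℝ := fun x => (ifigDensity P α a b σ δ k₂ x).re with hf
  have hD : ∀ x, ifigDensity P α a b σ δ k₂ x = (f x : ℂ) := fun x =>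
    Complex.ext (by simp [hf]) (by simpa using hX.density_real x)
  have hDr : ∀ x : ℝ, ((x ^ r : ℝ) : ℂ) * ifigDensity P α a b σ δ k₂ x =
      ((f x • x ^ r : ℝ) : ℂ) := fun x => by
    rw [hD, smul_eq_mul, mul_comm]; push_cast; rfl
  simp only [hDr] at hi ⊢
  rw [integral_complex_ofReal]
  have hir : Integrable fun x : ℝ => f x • x ^ r := by simpa using hi.re
  -- Measurability of the density is recovered from integrability of `x^r f`, multiplying back by
  -- `x^{-r}` on `x > 0`.
  have hfm : AEMeasurable f := by
    have h1 : f = fun x => Set.indicator (Set.Ioi 0) (fun x : ℝ => x ^ (-r) * (f x • x ^ r)) x := by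
      funext x
      by_cases hx : 0 < x
      · rw [Set.indicator_of_mem (show x ∈ Set.Ioi (0 : ℝ) from hx), Real.rpow_neg hx.le,
          smul_eq_mul]
        have := (Real.rpow_pos_of_pos hx r).ne'
        field_simp
      · rw [Set.indicator_of_notMem (show x ∉ Set.Ioi (0 : ℝ) from hx)]
        simp [hf, ifigDensity, hx]
    rw [h1]
    exact ((by fun_prop : Measurable fun x : ℝ => x ^ (-r)).aemeasurable.mul
      hir.aemeasurable).indicator measurableSet_Ioi
  have hlaw : μ.map X = volume.withDensity fun x => ENNReal.ofReal (f x) := hX.law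
  have hofm : AEMeasurable (fun x => ENNReal.ofReal (f x)) := hfm.ennreal_ofReal
  have hlt : ∀ᵐ x ∂(volume : Measure ℝ), ENNReal.ofReal (f x) < ⊤ :=
    Eventually.of_forall fun x => ENNReal.ofReal_lt_top
  have hto : ∀ x, (ENNReal.ofReal (f x)).toReal = f x := fun x =>
    ENNReal.toReal_ofReal (hX.density_nonneg x)
  have hmeas : Measurable fun x : ℝ => x ^ r := by fun_prop
  have himap : Integrable (fun x : ℝ => x ^ r) (μ.map X) := by
    rw [hlaw, integrable_withDensity_iff_integrable_smul₀' hofm hlt]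
    simpa only [hto] using hir
  refine ⟨(integrable_map_measure hmeas.aestronglyMeasurable hX.aemeasurable).mp himap, ?_⟩
  congr 1
  rw [← integral_map hX.aemeasurable (f := fun x : ℝ => x ^ r) hmeas.aestronglyMeasurable, hlaw,
    integral_withDensity_eq_integral_toReal_smul₀ hofm hlt]
  simp only [hto]

theorem IsIFIG.moment {Ω : Type*} [MeasurableSpace Ω] {μ : Measure Ω}
    {X : Ω → ℝ} {P : IParams} {α a b σ : ℝ} {δ k₂ : ℂ}
    (hX : IsIFIG μ X P α a b σ δ k₂) (haσ : a = 0 → σ = 0) {r : ℝ} (hr : 0 ≤ r)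
    (har : a = 0 → α + r < 0) (hpath : HasMomentPath P α σ δ r) :
    (∀ l : ℕ, (P.momentFst α σ r l).Defined (δ / ((a ^ σ : ℝ) : ℂ)) ∧
        (b ≠ 0 → (P.momentSnd α σ r l).Defined (((b ^ σ : ℝ) : ℂ) * δ))) ∧
      Integrable (fun ω => X ω ^ r) μ ∧
      Summable (fun l : ℕ => ifigMomentTerm P α a b σ δ r l) ∧
      ((∫ ω, X ω ^ r ∂μ : ℝ) : ℂ) = k₂ * ∑' l : ℕ, ifigMomentTerm P α a b σ δ r l := by
  obtain ⟨c, hpq, habs⟩ := hpath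
  have hp := fun l => (hpq l).1
  have hq := fun l => (hpq l).2
  have hP := hX.valid.isNonneg
  have hδ : δ ≠ 0 := hX.defined.1
  have hσ := hX.sigma_nonneg
  -- `b = 0` is possible only for `α > 0`, and then `r ≥ 0` gives `α + r > 0`, as convergence at `0`
  -- requires.
  have hcases : 0 ≤ a ∧ 0 ≤ b ∧ (a ≠ 0 ∨ b ≠ 0) ∧ (b = 0 → 0 < α + r) := by
    rcases lt_trichotomy α 0 with h | h | h
    · obtain ⟨h1, h2⟩ := hX.of_neg h
      exact ⟨h1, h2.le, Or.inr h2.ne', fun h3 => absurd h3 h2.ne'⟩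
    · obtain ⟨h1, h2⟩ := hX.of_zero h
      exact ⟨h1.le, h2.le, Or.inr h2.ne', fun h3 => absurd h3 h2.ne'⟩
    · obtain ⟨h1, h2⟩ := hX.of_pos h
      exact ⟨h1.le, h2, Or.inl h1.ne', fun _ => by linarith⟩
  obtain ⟨ha, hb, hab, hbα⟩ := hcases
  have haσ' : 0 < a ^ σ := by
    rcases ha.eq_or_lt with h | h
    · rw [haσ h.symm, Real.rpow_zero]; exact one_pos
    · exact Real.rpow_pos_of_pos h σ
  have hbσ : b ^ (α + r) = 0 ∨ 0 < b ^ σ := by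
    rcases hb.eq_or_lt with h | h
    · left; rw [← h, Real.zero_rpow (hbα h.symm).ne']
    · exact Or.inr (Real.rpow_pos_of_pos h σ)
  have hbessel := hasSum_besselTerm_linePower ha hb hσ hab (fun h => ⟨haσ h, har h⟩) hbα (hp 0)
  have hsum := IParams.hasSum_ifigMomentTerm hP ha hb hσ hδ hp hq habs haσ' hbσ
    fun t => (hbessel t).2
  obtain ⟨hi, hval⟩ := moment_ifigDensity (k₂ := k₂) hP hδ (hp 0).of_momentFst habs (hbessel 0).1
  obtain ⟨hint, hmom⟩ := hX.integrable_rpow_and_integral hi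
  refine ⟨fun l => ⟨?_, fun hb0 => ?_⟩, hint, hsum.summable, ?_⟩
  · rw [show δ / ((a ^ σ : ℝ) : ℂ) = (((a ^ σ)⁻¹ : ℝ) : ℂ) * δ by
      rw [Complex.ofReal_inv, div_eq_inv_mul]]
    have hy := inv_pos.mpr haσ'
    exact ⟨mul_ne_zero (by exact_mod_cast hy.ne') hδ, c, hp l,
      (habs.ofReal_mul hy hδ).momentFst (hp 0) hσ l⟩
  · have hy := Real.rpow_pos_of_pos (lt_of_le_of_ne hb hb0.symm) σ
    exact ⟨mul_ne_zero (by exact_mod_cast hy.ne') hδ, c, hq l,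
      (habs.ofReal_mul hy hδ).momentSnd (hp 0) hσ l⟩
  · rw [hmom, hval, hsum.tsum_eq]

end

theorem corollary5p2 {Ω : Type*} [MeasurableSpace Ω] (μ : Measure Ω) [IsProbabilityMeasure μ]
    (X : Ω → ℝ) (P : IParams) (α a b σ : ℝ) (δ k₂ : ℂ)
    (hX : IsIFIG μ X P α a b σ δ k₂) (haσ : a = 0 → σ = 0) :
    (∀ r : ℝ, 0 ≤ r → (a = 0 → α + r < 0) → HasMomentPath P α σ δ r →
      (∀ l : ℕ, (P.momentFst α σ r l).Defined (δ / ((a ^ σ : ℝ) : ℂ)) ∧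
        (b ≠ 0 → (P.momentSnd α σ r l).Defined (((b ^ σ : ℝ) : ℂ) * δ))) ∧
      Integrable (fun ω => X ω ^ r) μ ∧
      Summable (fun l : ℕ => ifigMomentTerm P α a b σ δ r l) ∧
      ((∫ ω, X ω ^ r ∂μ : ℝ) : ℂ) = k₂ * ∑' l : ℕ, ifigMomentTerm P α a b σ δ r l) ∧
    (HasMomentPath P α σ δ 0 →
      Summable (fun l : ℕ => ifigMomentTerm P α a b σ δ 0 l) ∧
      k₂ ≠ 0 ∧
      k₂⁻¹ = ∑' l : ℕ, ifigMomentTerm P α a b σ δ 0 l) := by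
  refine ⟨fun r hr har hpath => hX.moment haσ hr har hpath, fun hpath => ?_⟩
  have ha0 : a = 0 → α + 0 < 0 := fun h => by
    rcases lt_trichotomy α 0 with h' | h' | h'
    · simpa using h'
    · exact absurd h (hX.of_zero h').1.ne'
    · exact absurd h (hX.of_pos h').1.ne'
  obtain ⟨-, -, hsum, heq⟩ := hX.moment haσ le_rfl ha0 hpath
  -- The zeroth moment is the total mass `1`, since `X ω ^ 0 = 1` everywhere.
  have h1 : k₂ * ∑' l : ℕ, ifigMomentTerm P α a b σ δ 0 l = 1 := by
    rw [← heq]; simp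
  exact ⟨hsum, left_ne_zero_of_mul_eq_one h1, (eq_inv_of_mul_eq_one_right h1).symm⟩
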